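/- Let $dV$ be Lebesgue measure on $\mathbb{C}^n$, $z\cdot\overline w=\sum_j z_j\overline{w_j}$, $|z|^2=z\cdot\overline z$, and $d\mu(z)=\pi^{-n}e^{-|z|^2}dV(z)$. Let $F^2$ be the Fock space of all entire functions in $L^2(\mathbb{C}^n,d\mu)$, and let $K_a(w)=e^{w\cdot\overline a}$ be its reproducing kernels. Let $\mathrm{Sym}(\mathbb{C}^n)$ be the set of measurable functions $f$ on $\mathbb{C}^n$ such that $f(z)e^{-c|z|^2}$ is essentially bounded for every $c>0$. For a measurable symbol $\varphi$, the Toeplitz operator $T_\varphi$ is given by $$(T_\varphi k)(z)=\int_{\mathbb{C}^n}\varphi(w)k(w)e^{z\cdot\overline w}\,d\mu(w)$$ on the domain of all $k\in F^2$ for which this integral converges absolutely for every $z\in\mathbb{C}^n$. The product $T_\varphi T_\psi$ is defined at those $k$ in the domain of $T_\psi$ for which $T_\psi k$ belongs to the domain of $T_\varphi$ (in particular $T_\psi k\in F^2$). The equality $T_\varphi T_\psi=T_h$ means that $T_\varphi T_\psi k=T_hk$ for every $k\in F^2$ at which both sides are defined, and $T_\varphi T_\psi=0$ means that $T_\varphi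 T_\psi k=0$ for every $k$ at which the product is defined. Let $f,g,u,v\in\mathrm{Sym}(\mathbb{C}^n)$ be entire, and put $\varphi=f+\overline g$, $\psi=u+\overline v$. Let $v^*(z)=\overline{v(\overline z)}$, with Taylor expansion $v^*(z)=\sum_i a_iz^i$ over multi-indices $i\in\mathbb{N}^n$, and define $$v^*(\overline z-\partial_z)f(z)=\sum_{i}a_i\sum_{l\le i}\binom{i}{l}\,\overline z^{\,l}(-1)^{|i-l|}\,\partial^{i-l}f(z),$$ where $\binom{i}{l}=\prod_j\binom{i_j}{l_j}$. Then the outer series converges absolutely for every $z\in\mathbb{C}^n$; all kernels $K_a$ are in the domain of $T_\varphi T_\psi$, and in the domain of $T_h$ for every $h\in L^2(\mathbb{C}^n,d\mu)$; and: (a) For every $h\in L^2(\mathbb{C}^n,d\mu)$, $T_\varphi T_\psi=T_h$ if and only if $$h(z)=u(z)\overline{g(z)}+f(z)u(z)+\overline{g(z)}\,\overline{v(z)}+v^*(\overline z-\partial_z)f(z)\quad\text{for }\mu\text{-almost every }z.$$ (b) $T_\varphi T_\psi=0$ if and only if $$u(z)\overline{g(z)}+f(z)u(z)+\overline{g(z)}\,\overline{v(z)}+v^*(\overline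 z-\partial_z)f(z)=0\quad\text{for every }z\in\mathbb{C}^n.$$ -/

import Mathlib

open MeasureTheory
open scoped ComplexConjugate

noncomputable section

namespace Fock

/-- `ℂⁿ` (only its topology, its Lebesgue measure and its complex differentiable structure are
used; the Euclidean norm is written out as `normSq`). -/
abbrev Cn (n : ℕ) : Type := Fin n → ℂ

variable {n : ℕ}

/-- `|z|² = ∑ |z_j|²`. -/
def normSq (z : Cn n) : ℝ := ∑ j, ‖z j‖ ^ 2

/-- `z · w̄ = ∑ z_j w̄_j`. -/
def dotConj (z w : Cn n) : ℂ := ∑ j, z j * conj (w j)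

/-- The Gaussian probability measure `dμ(z) = π⁻ⁿ e^{-|z|²} dV(z)`. -/
def gauss (n : ℕ) : Measure (Cn n) :=
  (volume : Measure (Cn n)).withDensity
    fun z => ENNReal.ofReal (Real.exp (-normSq z) / Real.pi ^ n)

/-- The entire functions `H(ℂⁿ)`. -/
def Entire (f : Cn n → ℂ) : Prop := Differentiable ℂ f

/-- The space `𝒟_c`: measurable functions `f` with `f(z) e^{-c|z|²}` essentially bounded. -/
def InD (c : ℝ) (f : Cn n → ℂ) : Prop :=
  Measurable f ∧ ∃ C : ℝ, ∀ᵐ z : Cn n, ‖f z‖ * Real.exp (-c * normSq z) ≤ C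

/-- The symbol space `Sym(ℂⁿ) = ⋂_{c > 0} 𝒟_c`. -/
def InSym (f : Cn n → ℂ) : Prop := ∀ c : ℝ, 0 < c → InD c f

/-- The Fock space `F² = L²(ℂⁿ, dμ) ∩ H(ℂⁿ)`. -/
def InFock (k : Cn n → ℂ) : Prop := Entire k ∧ MemLp k 2 (gauss n)

/-- The reproducing kernel `K(z, w) = e^{z · w̄}`. -/
def kernel (z w : Cn n) : ℂ := Complex.exp (dotConj z w)

/-- The projection onto `F²`, given by `(P F)(z) = ∫ F(w) K(z, w) dμ(w)`. -/
def proj (F : Cn n → ℂ) (z : Cn n) : ℂ := ∫ w, F w * kernel z w ∂(gauss n)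

/-- `T_φ k = P(φ k)`. -/
def toeplitz (φ k : Cn n → ℂ) : Cn n → ℂ := proj fun w => φ w * k w

/-- `k` is in the domain of `T_φ`: `k ∈ F²` and the integral that defines `(T_φ k)(z)` converges
absolutely for every `z`. -/
def InDom (φ k : Cn n → ℂ) : Prop :=
  InFock k ∧ ∀ z, Integrable (fun w => φ w * k w * kernel z w) (gauss n)

/-- `k` is in the domain of `T_φ T_ψ`: `k` is in the domain of `T_ψ`, and `T_ψ k` is in the domain
of `T_φ` (so `T_ψ k ∈ F²`). -/
def InDomMul (φ ψ k : Cn n → ℂ) : Prop := InDom ψ k ∧ InDom φ (toeplitz ψ k)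

/-- `T_φ T_ψ = T_h`: both sides agree wherever both are defined. -/
def ToeplitzMulEq (φ ψ h : Cn n → ℂ) : Prop :=
  ∀ k : Cn n → ℂ, InDomMul φ ψ k → InDom h k →
    ∀ z, toeplitz φ (toeplitz ψ k) z = toeplitz h k z

/-- `T_φ T_ψ = 0`. -/
def ToeplitzMulEqZero (φ ψ : Cn n → ℂ) : Prop :=
  ∀ k : Cn n → ℂ, InDomMul φ ψ k → ∀ z, toeplitz φ (toeplitz ψ k) z = 0

/-- The complex partial derivative `∂_j`. -/
def pderiv (j : Fin n) (f : Cn n → ℂ) (z : Cn n) : ℂ := fderiv ℂ f z (Pi.single j 1)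

/-- `∂^i = ∂_1^{i_1} ⋯ ∂_n^{i_n}`. -/
def multiDeriv (i : Fin n → ℕ) (f : Cn n → ℂ) : Cn n → ℂ :=
  (List.finRange n).foldr (fun j F => (pderiv j)^[i j] F) f

/-- The coefficient of `z^i` in the Taylor expansion at `0`, i.e. `∂^i f(0) / i!`. -/
def taylorCoeff (f : Cn n → ℂ) (i : Fin n → ℕ) : ℂ :=
  multiDeriv i f 0 / ∏ j, ((i j).factorial : ℂ)

/-- `f^*(z) = conj (f (z̄))`. -/
def conjStar (f : Cn n → ℂ) (z : Cn n) : ℂ := conj (f fun j => conj (z j))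

/-- `(z̄ - ∂_z)^i f(z) = ∑_{l ≤ i} (i choose l) z̄^l (-1)^{|i-l|} ∂^{i-l} f(z)`. -/
def conjSubDerivPow (i : Fin n → ℕ) (f : Cn n → ℂ) (z : Cn n) : ℂ :=
  ∑ l ∈ Finset.Iic i, (∏ j, ((i j).choose (l j) : ℂ)) * (∏ j, conj (z j) ^ l j) *
    (-1) ^ (∑ j, (i j - l j)) * multiDeriv (i - l) f z

/-- The terms of the series `F(z̄ - ∂_z) f(z) = ∑_i a_i (z̄ - ∂_z)^i f(z)`, `F(z) = ∑_i a_i z^i`. -/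
def conjSubDerivTerm (F f : Cn n → ℂ) (z : Cn n) (i : Fin n → ℕ) : ℂ :=
  taylorCoeff F i * conjSubDerivPow i f z

/-- `F(z̄ - ∂_z) f(z)`. -/
def conjSubDeriv (F f : Cn n → ℂ) (z : Cn n) : ℂ := ∑' i, conjSubDerivTerm F f z i

/-- `u ḡ + f u + ḡ v̄ + v^*(z̄ - ∂_z) f(z)`. -/
def productSymbol (f g u v : Cn n → ℂ) (z : Cn n) : ℂ :=
  u z * conj (g z) + f z * u z + conj (g z) * conj (v z) + conjSubDeriv (conjStar v) f z

end Fock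

end

namespace Fock

/-! Everything reduces to reproducing kernels. By the reproducing formula and its conjugate, a
symbol $f+\overline g$ acts by $T_{f+\overline g}K_a=(f+\overline{g(a)})K_a$ (`toeplitz_kernel`).
Fubini then turns $T_\varphi T_\psi k(z)$ into $\int
\psi(x)k(x)(f(z)+\overline{g(x)})e^{z\cdot\overline x}\,d\mu(x)$ for every $k\in F^2$. This differs
from a Toeplitz operator only in that $f$ is evaluated at $z$ and not at $x$. For the term
$f(z)u(x)$ the correction is $f(x)u(x)$, since both reproduce $f(z)u(z)$. For $f(z)\overline{v(x)}$
it is the function $S(x)=\int f(w)\overline{v(x-w)}e^{x\cdot\overline w}\,d\mu(w)$ (`convSymbol`),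
because $T_SK_a=\overline{v(a)}fK_a$. Differentiating the reproducing formula gives $(\overline
z-\partial_z)^if(z)=\int f(w)(\overline z-\overline w)^ie^{z\cdot\overline w}\,d\mu(w)$, and summing
against the Taylor coefficients of $v^*$ identifies $S$ with $v^*(\overline z-\partial_z)f$. So
$T_\varphi T_\psi=T_\sigma$ on all of $F^2$, where $\sigma$ is the symbol in the theorem: the two
sides agree on kernels, and every $k\in F^2$ is a superposition of kernels
(`integral_mul_eq_zero_of_kernel`). Conversely, an $L^2$ symbol is determined by its action on
kernels: $K_a(x)K_x(-a)$ runs over all characters of $\mathbb{R}^{2n}$, so Fourier uniqueness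
applies. -/

/-! ### The Gaussian measure -/

theorem continuous_normSq {n : ℕ} : Continuous (normSq : Cn n → ℝ) := by
  unfold normSq; fun_prop

theorem normSq_nonneg {n : ℕ} (z : Cn n) : 0 ≤ normSq z :=
  Finset.sum_nonneg fun _ _ => by positivity

theorem measurable_gauss_density {n : ℕ} :
    Measurable fun z : Cn n => ENNReal.ofReal (Real.exp (-normSq z) / Real.pi ^ n) := by
  have := (continuous_normSq (n := n)).measurable
  fun_prop

theorem integrable_gauss_iff {n : ℕ} {E : Type*} [NormedAddCommGroup E] [NormedSpace ℝ E]
    {F : Cn n → E} :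
    Integrable F (gauss n) ↔
      Integrable (fun z => (Real.exp (-normSq z) / Real.pi ^ n) • F z) volume := by
  have h := integrable_withDensity_iff_integrable_smul' (μ := (volume : Measure (Cn n)))
    (f := fun z : Cn n => ENNReal.ofReal (Real.exp (-normSq z) / Real.pi ^ n)) (g := F)
    measurable_gauss_density (ae_of_all _ fun _ => ENNReal.ofReal_lt_top)
  rw [gauss, h]
  refine iff_of_eq (congrArg (fun G : Cn n → E => Integrable G volume) (funext fun z => ?_))
  rw [ENNReal.toReal_ofReal (by positivity)]

theorem integral_gauss {n : ℕ} {E : Type*} [NormedAddCommGroup E] [NormedSpace ℝ E]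
    (F : Cn n → E) :
    ∫ z, F z ∂(gauss n) = ∫ z, (Real.exp (-normSq z) / Real.pi ^ n) • F z := by
  rw [gauss, integral_withDensity_eq_integral_toReal_smul measurable_gauss_density
    (ae_of_all _ fun _ => ENNReal.ofReal_lt_top)]
  refine integral_congr_ae (ae_of_all _ fun z => ?_)
  simp only
  rw [ENNReal.toReal_ofReal (by positivity)]

theorem exp_mul_normSq {n : ℕ} (c : ℝ) (z : Cn n) :
    Real.exp (c * normSq z) = ∏ j, Real.exp (c * ‖z j‖ ^ 2) := by
  rw [normSq, Finset.mul_sum, Real.exp_sum]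

theorem integral_exp_neg_normSq (n : ℕ) :
    ∫ z : Cn n, Real.exp (-normSq z) = Real.pi ^ n := by
  have h1 : ∫ x : ℂ, Real.exp (-1 * ‖x‖ ^ 2) = Real.pi := by
    rw [GaussianFourier.integral_rexp_neg_mul_sq_norm one_pos]
    simp [Complex.finrank_real_complex]
  have : ∀ z : Cn n, Real.exp (-normSq z) = ∏ j, Real.exp (-1 * ‖z j‖ ^ 2) := fun z => by
    rw [← exp_mul_normSq, neg_one_mul]
  simp_rw [this]
  rw [integral_fintype_prod_volume_eq_prod (f := fun (_ : Fin n) (x : ℂ) => Real.exp (-1 * ‖x‖ ^ 2))]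
  simp only [h1, Finset.prod_const, Finset.card_univ, Fintype.card_fin]

theorem integrable_exp_neg_mul_normSq_volume {n : ℕ} {b : ℝ} (hb : 0 < b) :
    Integrable (fun z : Cn n => Real.exp (-b * normSq z)) := by
  have h1 : Integrable fun x : ℂ => Real.exp (-b * ‖x‖ ^ 2) := by
    have := (GaussianFourier.integrable_cexp_neg_mul_sq_norm_add (V := ℂ) (b := (b : ℂ))
      (by simpa using hb) 0 0).norm
    refine this.congr (ae_of_all _ fun x => ?_)
    simp only [Complex.norm_exp]
    congr 1
    simp [← Complex.ofReal_pow, ← Complex.ofReal_neg, ← Complex.ofReal_mul]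
  simp_rw [exp_mul_normSq]
  exact Integrable.fintype_prod (f := fun (_ : Fin n) (x : ℂ) => Real.exp (-b * ‖x‖ ^ 2))
    fun _ => h1

theorem integrable_exp_mul_normSq {n : ℕ} {c : ℝ} (hc : c < 1) :
    Integrable (fun z : Cn n => Real.exp (c * normSq z)) (gauss n) := by
  rw [integrable_gauss_iff]
  refine ((integrable_exp_neg_mul_normSq_volume (sub_pos.2 hc)).div_const (Real.pi ^ n)).congr
    (ae_of_all _ fun z => ?_)
  simp only [smul_eq_mul]
  rw [div_mul_eq_mul_div, ← Real.exp_add]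
  ring_nf

instance isProbabilityMeasure_gauss (n : ℕ) : IsProbabilityMeasure (gauss n) := by
  have hi : Integrable (fun z : Cn n => (1 : ℝ)) (gauss n) := by
    simpa using integrable_exp_mul_normSq (n := n) (c := 0) one_pos
  have hfin : IsFiniteMeasure (gauss n) := by
    rcases integrable_const_iff.1 hi with h | h
    · norm_num at h
    · exact h
  have h : ∫ z : Cn n, (1 : ℝ) ∂(gauss n) = 1 := by
    rw [integral_gauss]
    simp only [smul_eq_mul, mul_one]
    rw [integral_div, integral_exp_neg_normSq, div_self (by positivity)]
  rw [integral_const, smul_eq_mul, mul_one] at h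
  constructor
  rw [← ENNReal.ofReal_toReal (measure_ne_top (gauss n) Set.univ)]
  rw [Measure.real] at h
  rw [h, ENNReal.ofReal_one]

theorem measurePreserving_gauss {n : ℕ} {A : Cn n → Cn n} (hA : MeasurePreserving A)
    (h : ∀ z, normSq (A z) = normSq z) : MeasurePreserving A (gauss n) (gauss n) := by
  refine ⟨hA.measurable, Measure.ext fun s hs => ?_⟩
  rw [Measure.map_apply hA.measurable hs, gauss, withDensity_apply _ hs,
    withDensity_apply _ (hA.measurable hs)]
  conv_rhs => rw [← hA.map_eq]
  rw [setLIntegral_map hs measurable_gauss_density hA.measurable]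
  simp_rw [h]

/-- Multiplication by a unimodular scalar is a rotation in each coordinate, and it fixes the
density. -/
theorem measurePreserving_smul_gauss {n : ℕ} {c : ℂ} (hc : ‖c‖ = 1) :
    MeasurePreserving (fun z : Cn n => c • z) (gauss n) (gauss n) := by
  refine measurePreserving_gauss ?_ fun z => by simp [normSq, hc]
  have h1 : MeasurePreserving fun z : ℂ => c * z :=
    (rotation ⟨c, mem_sphere_zero_iff_norm.2 hc⟩).measurePreserving
  exact volume_preserving_pi fun _ => h1

/-! ### The mean value property and the reproducing formula -/

/-- Rotation invariance allows $G(z)$ to be replaced by its average over $e^{i\theta}z$. That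
average is $G(0)$, by the mean value property of $s\mapsto G(sz)$ on the unit circle. -/
theorem integral_gauss_of_entire {n : ℕ} {G : Cn n → ℂ} (hG : Entire G)
    (hi : Integrable G (gauss n)) : ∫ z, G z ∂(gauss n) = G 0 := by
  have hc : ∀ θ : ℝ, ‖circleMap 0 1 θ‖ = 1 := fun θ => by simp
  have hme : ∀ θ : ℝ, MeasurePreserving (fun z : Cn n => circleMap 0 1 θ • z) (gauss n) (gauss n) :=
    fun θ => measurePreserving_smul_gauss (hc θ)
  have hemb : ∀ θ : ℝ, MeasurableEmbedding (fun z : Cn n => circleMap 0 1 θ • z) := fun θ =>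
    (Homeomorph.smulOfNeZero (circleMap 0 1 θ) (by
      intro h; have := hc θ; rw [h] at this; simp at this)).measurableEmbedding
  have hcont : Continuous G := hG.continuous
  have hF : Continuous fun p : ℝ × Cn n => G (circleMap 0 1 p.1 • p.2) := by
    have : Continuous (circleMap 0 1) := continuous_circleMap 0 1
    fun_prop
  have hprod : Integrable (fun p : ℝ × Cn n => G (circleMap 0 1 p.1 • p.2))
      ((volume.restrict (Set.Ioc 0 (2 * Real.pi))).prod (gauss n)) := by
    rw [integrable_prod_iff hF.aestronglyMeasurable]
    refine ⟨ae_of_all _ fun θ => ?_, ?_⟩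
    · exact ((hme θ).integrable_comp_emb (hemb θ)).2 hi
    · simp only
      have : ∀ θ : ℝ, ∫ z, ‖G (circleMap 0 1 θ • z)‖ ∂(gauss n) = ∫ z, ‖G z‖ ∂(gauss n) :=
        fun θ => (hme θ).integral_comp (hemb θ) fun z => ‖G z‖
      simp_rw [this]
      exact integrable_const _
  have hswap := integral_integral_swap
    (f := fun (θ : ℝ) (z : Cn n) => G (circleMap 0 1 θ • z)) hprod
  have hl : ∀ θ : ℝ, ∫ z, G (circleMap 0 1 θ • z) ∂(gauss n) = ∫ z, G z ∂(gauss n) :=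
    fun θ => (hme θ).integral_comp (hemb θ) G
  have hr : ∀ z : Cn n, ∫ θ in Set.Ioc 0 (2 * Real.pi), G (circleMap 0 1 θ • z)
      = (2 * Real.pi : ℝ) • G 0 := fun z => by
    have hd : Differentiable ℂ fun s : ℂ => G (s • z) := by
      have : Differentiable ℂ G := hG
      fun_prop
    have := (hd.diffContOnCl (s := Metric.ball 0 |(1 : ℝ)|)).circleAverage
    rw [Real.circleAverage, intervalIntegral.integral_of_le (by positivity)] at this
    rw [zero_smul] at this
    rw [← this, smul_smul, mul_inv_cancel₀ (by positivity), one_smul]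
  simp only [hl, hr, integral_const, smul_smul] at hswap
  simp only [probReal_univ, one_mul, measureReal_restrict_apply_univ, Real.volume_real_Ioc,
    sub_zero] at hswap
  rw [max_eq_left (by positivity)] at hswap
  exact smul_right_injective ℂ (r := (2 * Real.pi : ℝ)) (by positivity) hswap

theorem dotConj_self {n : ℕ} (z : Cn n) : dotConj z z = normSq z := by
  simp [dotConj, normSq, Complex.mul_conj, Complex.normSq_eq_norm_sq]

theorem dotConj_add_left {n : ℕ} (z w a : Cn n) :
    dotConj (z + w) a = dotConj z a + dotConj w a := by
  simp [dotConj, add_mul, Finset.sum_add_distrib]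

theorem dotConj_add_right {n : ℕ} (z w a : Cn n) :
    dotConj z (w + a) = dotConj z w + dotConj z a := by
  simp [dotConj, mul_add, Finset.sum_add_distrib]

theorem conj_dotConj {n : ℕ} (z w : Cn n) : conj (dotConj z w) = dotConj w z := by
  simp [dotConj, mul_comm]

theorem kernel_add_right {n : ℕ} (z w a : Cn n) :
    kernel z (w + a) = kernel z w * kernel z a := by
  rw [kernel, dotConj_add_right, Complex.exp_add, kernel, kernel]

theorem conj_kernel {n : ℕ} (z w : Cn n) : conj (kernel z w) = kernel w z := by
  rw [kernel, ← Complex.exp_conj, conj_dotConj, kernel]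

theorem kernel_zero_left {n : ℕ} (w : Cn n) : kernel 0 w = 1 := by
  simp [kernel, dotConj]

theorem continuous_kernel {n : ℕ} : Continuous fun p : Cn n × Cn n => kernel p.1 p.2 := by
  unfold kernel dotConj
  have : Continuous (fun x : ℂ => conj x) := Complex.continuous_conj
  fun_prop

theorem entire_kernel {n : ℕ} (a : Cn n) : Entire fun z => kernel z a := by
  unfold kernel dotConj Entire
  fun_prop

/-- The reproducing formula, for every entire function for which the integral converges. -/
theorem integral_mul_kernel {n : ℕ} {F : Cn n → ℂ} (hF : Entire F) (z : Cn n)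
    (hi : Integrable (fun w => F w * kernel z w) (gauss n)) :
    ∫ w, F w * kernel z w ∂(gauss n) = F z := by
  -- The substitution $w=z+t$ completes the square:
  -- $-|z+t|^2+z\cdot\overline{(z+t)}=-|t|^2-t\cdot\overline z$. The new integrand is entire in $t$,
  -- so the mean value property at $t=0$ yields $F(z)$.
  have key : ∀ t : Cn n, (Real.exp (-normSq (z + t)) / Real.pi ^ n) • (F (z + t) * kernel z (z + t))
      = (Real.exp (-normSq t) / Real.pi ^ n) • (F (z + t) * kernel (-t) z) := fun t => by
    have h : (Real.exp (-normSq (z + t)) : ℂ) * kernel z (z + t)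
        = Real.exp (-normSq t) * kernel (-t) z := by
      rw [kernel, kernel, Complex.ofReal_exp, Complex.ofReal_exp, ← Complex.exp_add,
        ← Complex.exp_add]
      push_cast
      rw [← dotConj_self, ← dotConj_self]
      congr 1
      have hneg : dotConj (-t) z = - dotConj t z := by simp [dotConj]
      rw [hneg]
      simp only [dotConj_add_left, dotConj_add_right]
      ring
    simp only [Complex.real_smul, Complex.ofReal_div]
    linear_combination (F (z + t) / ((Real.pi ^ n : ℝ) : ℂ)) * h
  have hG : Entire fun t => F (z + t) * kernel (-t) z := by
    have h1 : Differentiable ℂ F := hF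
    have h2 : Differentiable ℂ fun w => kernel w z := entire_kernel z
    have h3 : Differentiable ℂ fun t : Cn n => kernel (-t) z := h2.comp differentiable_id.neg
    unfold Entire
    fun_prop
  have hGi : Integrable (fun t => F (z + t) * kernel (-t) z) (gauss n) := by
    rw [integrable_gauss_iff] at hi ⊢
    simpa only [key] using hi.comp_add_left z
  have := integral_gauss_of_entire hG hGi
  rw [integral_gauss] at this ⊢
  rw [← integral_add_left_eq_self _ z]
  simp only [key, this]
  simp [kernel_zero_left]

/-! ### Gaussian growth bounds -/

/-- Continuous functions bounded by a multiple of `e^{c|x|²}`. -/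
def Growth {n : ℕ} (c : ℝ) (F : Cn n → ℂ) : Prop :=
  Continuous F ∧ ∃ C : ℝ, 0 ≤ C ∧ ∀ x, ‖F x‖ ≤ C * Real.exp (c * normSq x)

/-- The essential bound holds on a closed set of full measure; such a set is dense, hence
everything. -/
theorem growth_of_inSym {n : ℕ} {f : Cn n → ℂ} (hf : InSym f ∧ Entire f) {c : ℝ} (hc : 0 < c) :
    Growth c f := by
  have hcont : Continuous f := hf.2.continuous
  obtain ⟨-, C, hC⟩ := hf.1 c hc
  have hN := continuous_normSq (n := n)
  have hclosed : IsClosed {z : Cn n | ‖f z‖ * Real.exp (-c * normSq z) ≤ C} :=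
    isClosed_le (by fun_prop) continuous_const
  have hd : Dense {z : Cn n | ‖f z‖ * Real.exp (-c * normSq z) ≤ C} := Measure.dense_of_ae hC
  have hall : ∀ z : Cn n, ‖f z‖ * Real.exp (-c * normSq z) ≤ C := fun z => by
    have : z ∈ closure {z : Cn n | ‖f z‖ * Real.exp (-c * normSq z) ≤ C} := hd z
    rwa [hclosed.closure_eq] at this
  refine ⟨hcont, C, le_trans (by positivity) (hall 0), fun x => ?_⟩
  have h := mul_le_mul_of_nonneg_right (hall x) (Real.exp_pos (c * normSq x)).le
  rwa [mul_assoc, ← Real.exp_add, neg_mul, neg_add_cancel, Real.exp_zero, mul_one] at h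

theorem Growth.mono {n : ℕ} {c d : ℝ} {F : Cn n → ℂ} (h : Growth c F) (hcd : c ≤ d) :
    Growth d F := by
  obtain ⟨hc, C, hC, hF⟩ := h
  refine ⟨hc, C, hC, fun x => (hF x).trans ?_⟩
  have := normSq_nonneg x
  gcongr

theorem Growth.add {n : ℕ} {c : ℝ} {F G : Cn n → ℂ} (hF : Growth c F) (hG : Growth c G) :
    Growth c fun x => F x + G x := by
  obtain ⟨hc, C, hC, hF⟩ := hF
  obtain ⟨hd, D, hD, hG⟩ := hG
  refine ⟨hc.add hd, C + D, by positivity, fun x => (norm_add_le _ _).trans ?_⟩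
  rw [add_mul]
  exact add_le_add (hF x) (hG x)

theorem Growth.mul {n : ℕ} {c d : ℝ} {F G : Cn n → ℂ} (hF : Growth c F) (hG : Growth d G) :
    Growth (c + d) fun x => F x * G x := by
  obtain ⟨hc, C, hC, hF⟩ := hF
  obtain ⟨hd, D, hD, hG⟩ := hG
  refine ⟨hc.mul hd, C * D, by positivity, fun x => ?_⟩
  rw [norm_mul, add_mul, Real.exp_add, mul_mul_mul_comm]
  exact mul_le_mul (hF x) (hG x) (norm_nonneg _) (by positivity)

theorem Growth.conj {n : ℕ} {c : ℝ} {F : Cn n → ℂ} (hF : Growth c F) :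
    Growth c fun x => conj (F x) := by
  obtain ⟨hc, C, hC, hF⟩ := hF
  exact ⟨Complex.continuous_conj.comp hc, C, hC, fun x => by simpa using hF x⟩

theorem Growth.const {n : ℕ} {c : ℝ} (hc : 0 ≤ c) (a : ℂ) : Growth c fun _ : Cn n => a := by
  refine ⟨continuous_const, ‖a‖, norm_nonneg _, fun x => ?_⟩
  have := normSq_nonneg x
  exact le_mul_of_one_le_right (norm_nonneg _) (Real.one_le_exp (by positivity))

theorem Growth.neg {n : ℕ} {c : ℝ} {F : Cn n → ℂ} (hF : Growth c F) :
    Growth c fun x => -F x := by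
  obtain ⟨hc, C, hC, hF⟩ := hF
  exact ⟨hc.neg, C, hC, fun x => by simpa using hF x⟩

theorem growth_exp_mul_normSq {n : ℕ} (c : ℝ) :
    Growth c fun x : Cn n => ((Real.exp (c * normSq x) : ℝ) : ℂ) := by
  have := continuous_normSq (n := n)
  refine ⟨by fun_prop, 1, zero_le_one, fun x => ?_⟩
  rw [Complex.norm_real, Real.norm_of_nonneg (Real.exp_pos _).le, one_mul]

theorem Growth.integrable {n : ℕ} {c : ℝ} {F : Cn n → ℂ} (hF : Growth c F) (hc : c < 1) :
    Integrable F (gauss n) := by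
  obtain ⟨hd, C, hC, hF⟩ := hF
  exact ((integrable_exp_mul_normSq hc).const_mul C).mono' hd.aestronglyMeasurable (ae_of_all _ hF)

theorem Growth.memLp {n : ℕ} {c : ℝ} {F : Cn n → ℂ} (hF : Growth c F) (hc : c < 1 / 2) :
    MemLp F 2 (gauss n) := by
  rw [memLp_two_iff_integrable_sq_norm hF.1.aestronglyMeasurable]
  refine ((hF.mul hF).integrable (by linarith)).norm.congr (ae_of_all _ fun x => ?_)
  simp [sq]

/-- Weighted AM-GM. The free weight `b` splits the kernel's growth unevenly between its two
variables, as each Fubini argument requires. -/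
theorem sum_norm_mul_norm_le {n : ℕ} {b : ℝ} (hb : 0 < b) (z w : Cn n) :
    ∑ j, ‖z j‖ * ‖w j‖ ≤ b * normSq z + 1 / (4 * b) * normSq w := by
  rw [normSq, normSq, Finset.mul_sum, Finset.mul_sum, ← Finset.sum_add_distrib]
  refine Finset.sum_le_sum fun j _ => ?_
  have h : 0 ≤ b * (‖z j‖ - 1 / (2 * b) * ‖w j‖) ^ 2 := by positivity
  have h2 : b * (‖z j‖ - 1 / (2 * b) * ‖w j‖) ^ 2
      = b * ‖z j‖ ^ 2 + 1 / (4 * b) * ‖w j‖ ^ 2 - ‖z j‖ * ‖w j‖ := by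
    field_simp; ring
  linarith

theorem norm_kernel_le {n : ℕ} {b : ℝ} (hb : 0 < b) (z w : Cn n) :
    ‖kernel z w‖ ≤ Real.exp (b * normSq z + 1 / (4 * b) * normSq w) := by
  rw [kernel, Complex.norm_exp]
  refine Real.exp_le_exp.2 ((Complex.re_le_norm _).trans ((norm_sum_le _ _).trans ?_))
  simpa only [norm_mul, RCLike.norm_conj] using sum_norm_mul_norm_le hb z w

theorem growth_kernel_left {n : ℕ} {c : ℝ} (hc : 0 < c) (a : Cn n) :
    Growth c fun x => kernel x a := by
  have h : Continuous fun x : Cn n => kernel x a :=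
    continuous_kernel.comp (continuous_id.prodMk continuous_const)
  refine ⟨h, Real.exp (1 / (4 * c) * normSq a), (Real.exp_pos _).le, fun x => ?_⟩
  rw [← Real.exp_add, add_comm]
  exact norm_kernel_le hc x a

theorem growth_kernel_right {n : ℕ} {c : ℝ} (hc : 0 < c) (z : Cn n) :
    Growth c fun x => kernel z x := by
  simpa only [conj_kernel] using (growth_kernel_left hc z).conj

theorem integrable_mul_of_inFock {n : ℕ} {c : ℝ} {k G : Cn n → ℂ} (hk : InFock k)
    (hG : Growth c G) (hc : c < 1 / 2) : Integrable (fun x => G x * k x) (gauss n) :=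
  (hG.memLp hc).integrable_mul hk.2

theorem inFock_of_growth {n : ℕ} {c : ℝ} {k : Cn n → ℂ} (hk : Entire k) (h : Growth c k)
    (hc : c < 1 / 2) : InFock k :=
  ⟨hk, h.memLp hc⟩

/-! ### Toeplitz operators and their products on kernels -/

/-- The kernel is split with weight $0.6$: the `x` side stays integrable because $c+0.6<1$. The `a`
side costs $1/(4\cdot0.6)<0.42$, and $0.42<1/2$ leaves room for `B` to contain a factor that is
merely in $L^2(\mu)$. -/
theorem integral_integral_kernel_swap {n : ℕ} {c : ℝ} {A B : Cn n → ℂ} (hA : Growth c A)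
    (hc : c < 0.4) (hB : Continuous B)
    (hBi : Integrable (fun x => ((Real.exp (0.42 * normSq x) : ℝ) : ℂ) * B x) (gauss n)) :
    ∫ x, A x * ∫ a, B a * kernel x a ∂(gauss n) ∂(gauss n)
      = ∫ a, B a * ∫ x, A x * kernel x a ∂(gauss n) ∂(gauss n) := by
  have hprod : Integrable (fun p : Cn n × Cn n => A p.1 * B p.2 * kernel p.1 p.2)
      ((gauss n).prod (gauss n)) := by
    have hAi := ((growth_exp_mul_normSq 0.6).mul hA).integrable (by linarith)
    refine (hAi.mul_prod hBi).mono ?_ (ae_of_all _ fun p => ?_)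
    · have := continuous_kernel (n := n)
      have := hA.1
      exact Continuous.aestronglyMeasurable (by fun_prop)
    · have h1 := norm_kernel_le (b := 0.6) (by norm_num) p.1 p.2
      have h2 : Real.exp (0.6 * normSq p.1 + 1 / (4 * 0.6) * normSq p.2)
          ≤ Real.exp (0.6 * normSq p.1) * Real.exp (0.42 * normSq p.2) := by
        rw [← Real.exp_add]
        have := normSq_nonneg p.2
        gcongr
        norm_num
      simp only [norm_mul, Complex.norm_real, Real.norm_of_nonneg (Real.exp_pos _).le]
      calc ‖A p.1‖ * ‖B p.2‖ * ‖kernel p.1 p.2‖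
          ≤ ‖A p.1‖ * ‖B p.2‖ * (Real.exp (0.6 * normSq p.1) * Real.exp (0.42 * normSq p.2)) := by
            gcongr; exact h1.trans h2
        _ = _ := by ring
  have := integral_integral_swap (f := fun x a => A x * B a * kernel x a) hprod
  simp only [← integral_const_mul]
  calc _ = ∫ x, ∫ a, A x * B a * kernel x a ∂(gauss n) ∂(gauss n) := by simp only [mul_assoc]
    _ = _ := this
    _ = _ := by
      congr 1; ext a; congr 1; ext x; ring

theorem integral_mul_kernel_mul_kernel {n : ℕ} {f : Cn n → ℂ} (hf : Entire f)
    (hf' : ∀ c > 0, Growth c f) (a z : Cn n) :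
    ∫ w, f w * kernel w a * kernel z w ∂(gauss n) = f z * kernel z a := by
  refine integral_mul_kernel (F := fun w => f w * kernel w a)
    (Differentiable.mul hf (entire_kernel a)) z ?_
  exact (((hf' 0.1 (by norm_num)).mul (growth_kernel_left (c := 0.1) (by norm_num) a)).mul
    (growth_kernel_right (c := 0.1) (by norm_num) z)).integrable (by norm_num)

theorem integral_conj_mul_kernel_mul_kernel {n : ℕ} {g : Cn n → ℂ} (hg : Entire g)
    (hg' : ∀ c > 0, Growth c g) (a z : Cn n) :
    ∫ w, conj (g w) * kernel w a * kernel z w ∂(gauss n) = conj (g a) * kernel z a := by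
  -- Conjugation exchanges the roles of `a` and `z`, so the antiholomorphic factor is evaluated at
  -- `a`.
  have h := congrArg conj (integral_mul_kernel_mul_kernel hg hg' z a)
  rw [← integral_conj] at h
  simp only [map_mul, conj_kernel] at h
  rw [← h]
  congr 1; ext w; ring

theorem toeplitz_kernel {n : ℕ} {f g φ : Cn n → ℂ} (hf : Entire f) (hf' : ∀ c > 0, Growth c f)
    (hg : Entire g) (hg' : ∀ c > 0, Growth c g) (hφ : ∀ z, φ z = f z + conj (g z)) (a z : Cn n) :
    toeplitz φ (fun w => kernel w a) z = (f z + conj (g a)) * kernel z a := by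
  have hK : Growth 0.2 fun w => kernel w a * kernel z w :=
    ((growth_kernel_left (c := 0.1) (by norm_num) a).mul
      (growth_kernel_right (c := 0.1) (by norm_num) z)).mono (by norm_num)
  have h1 := ((hf' 0.1 (by norm_num)).mul hK).integrable (by norm_num)
  have h2 := ((hg' 0.1 (by norm_num)).conj.mul hK).integrable (by norm_num)
  have h := integral_add h1 h2
  simp only [← mul_assoc] at h
  rw [integral_mul_kernel_mul_kernel hf hf', integral_conj_mul_kernel_mul_kernel hg hg'] at h
  rw [add_mul, ← h, toeplitz, proj]
  simp only [hφ, add_mul]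

/-- The product `T_φ T_ψ` as an integral operator, on all of `F²`. -/
theorem toeplitz_toeplitz {n : ℕ} {f g φ ψ : Cn n → ℂ} (hf : Entire f)
    (hf' : ∀ c > 0, Growth c f) (hg : Entire g) (hg' : ∀ c > 0, Growth c g)
    (hφ : ∀ z, φ z = f z + conj (g z)) (hψ : ∀ c > 0, Growth c ψ) {k : Cn n → ℂ}
    (hk : InFock k) (z : Cn n) :
    toeplitz φ (toeplitz ψ k) z
      = ∫ x, ψ x * k x * ((f z + conj (g x)) * kernel z x) ∂(gauss n) := by
  have hφ' : Growth 0.1 φ := by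
    have := (hf' 0.1 (by norm_num)).add (hg' 0.1 (by norm_num)).conj
    simpa only [← hφ] using this
  have hA : Growth 0.2 fun w => φ w * kernel z w :=
    (hφ'.mul (growth_kernel_right (c := 0.1) (by norm_num) z)).mono (by norm_num)
  have hB : Integrable (fun x => ((Real.exp (0.42 * normSq x) : ℝ) : ℂ) * (ψ x * k x))
      (gauss n) := by
    simp only [← mul_assoc]
    exact integrable_mul_of_inFock hk
      ((growth_exp_mul_normSq 0.42).mul (hψ 0.01 (by norm_num))) (by norm_num)
  -- After the interchange the inner integral is $T_\varphi K_x(z)$.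
  have h := integral_integral_kernel_swap hA (by norm_num)
    (((hψ 1 one_pos).1).mul hk.1.continuous) hB
  calc toeplitz φ (toeplitz ψ k) z
      = ∫ w, φ w * kernel z w * ∫ x, ψ x * k x * kernel w x ∂(gauss n) ∂(gauss n) := by
        rw [toeplitz, proj]
        congr 1; ext w
        rw [toeplitz, proj]; ring
    _ = _ := h
    _ = _ := by
        congr 1; ext x
        rw [← toeplitz_kernel hf hf' hg hg' hφ, toeplitz, proj]
        congr 2; ext w; ring

/-! ### The symbol that replaces $f(z)\overline{v(x)}$ -/

theorem normSq_sub_le {n : ℕ} (x w : Cn n) : normSq (x - w) ≤ 2 * normSq x + 2 * normSq w := by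
  rw [normSq, normSq, normSq, Finset.mul_sum, Finset.mul_sum, ← Finset.sum_add_distrib]
  refine Finset.sum_le_sum fun j _ => ?_
  have h : ‖(x - w) j‖ ≤ ‖x j‖ + ‖w j‖ := norm_sub_le _ _
  nlinarith [norm_nonneg ((x - w) j), sq_nonneg (‖x j‖ - ‖w j‖), norm_nonneg (x j),
    norm_nonneg (w j)]

theorem Growth.comp_sub {n : ℕ} {c : ℝ} {F : Cn n → ℂ} (hF : Growth c F) (hc : 0 ≤ c) (w : Cn n) :
    Growth (2 * c) fun x => F (x - w) := by
  obtain ⟨hd, C, hC, hF⟩ := hF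
  refine ⟨hd.comp (continuous_id.sub continuous_const), C * Real.exp (c * (2 * normSq w)),
    by positivity, fun x => (hF _).trans ?_⟩
  rw [mul_assoc, ← Real.exp_add]
  have h := mul_le_mul_of_nonneg_left (normSq_sub_le x w) hc
  gcongr
  linarith

/-- The integral form of `v^*(z̄ - ∂_z) f(z)`. -/
noncomputable def convSymbol {n : ℕ} (f v : Cn n → ℂ) (x : Cn n) : ℂ :=
  ∫ w, f w * conj (v (x - w)) * kernel x w ∂(gauss n)

/-- With kernel weight $0.28$ the exponents are $0.28+0.02=0.3$ in `x`, below the $1/2$ needed for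
$L^2(\mu)$, and $1/1.12+0.03<0.94$ in `w`, below the $1$ needed for integrability. -/
theorem norm_convSymbol_integrand_le {n : ℕ} {f v : Cn n → ℂ} (hf : Growth 0.01 f)
    (hv : Growth 0.01 v) : ∃ C : ℝ, 0 ≤ C ∧ ∀ x w, ‖f w * conj (v (x - w)) * kernel x w‖
      ≤ C * Real.exp (0.3 * normSq x) * Real.exp (0.94 * normSq w) := by
  obtain ⟨-, C, hC, hf⟩ := hf
  obtain ⟨-, D, hD, hv⟩ := hv
  refine ⟨C * D, by positivity, fun x w => ?_⟩
  have h1 := norm_kernel_le (b := 0.28) (by norm_num) x w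
  rw [norm_mul, norm_mul, RCLike.norm_conj]
  calc ‖f w‖ * ‖v (x - w)‖ * ‖kernel x w‖
      ≤ (C * Real.exp (0.01 * normSq w)) * (D * Real.exp (0.01 * normSq (x - w)))
        * Real.exp (0.28 * normSq x + 1 / (4 * 0.28) * normSq w) := by
        gcongr
        · exact hf w
        · exact hv _
    _ = C * D * Real.exp (0.01 * normSq w + 0.01 * normSq (x - w)
          + (0.28 * normSq x + 1 / (4 * 0.28) * normSq w)) := by
        rw [Real.exp_add (_ + _), Real.exp_add (0.01 * normSq w)]; ring
    _ ≤ C * D * Real.exp (0.3 * normSq x + 0.94 * normSq w) := by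
        have := normSq_sub_le x w
        have := normSq_nonneg w
        refine mul_le_mul_of_nonneg_left (Real.exp_le_exp.2 ?_) (by positivity)
        norm_num at *
        linarith
    _ = _ := by rw [Real.exp_add]; ring

theorem continuous_convSymbol_integrand {n : ℕ} {f v : Cn n → ℂ} (hf : Continuous f)
    (hv : Continuous v) :
    Continuous fun p : Cn n × Cn n => f p.2 * conj (v (p.1 - p.2)) * kernel p.1 p.2 := by
  have h1 := continuous_kernel (n := n)
  have h2 : Continuous fun x : ℂ => conj x := Complex.continuous_conj
  have h3 : Continuous fun p : Cn n × Cn n => conj (v (p.1 - p.2)) :=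
    h2.comp (hv.comp (continuous_fst.sub continuous_snd))
  fun_prop

theorem growth_convSymbol {n : ℕ} {f v : Cn n → ℂ} (hf : Growth 0.01 f) (hv : Growth 0.01 v) :
    Growth 0.3 (convSymbol f v) := by
  obtain ⟨C, hC, hb⟩ := norm_convSymbol_integrand_le hf hv
  have hcont := continuous_convSymbol_integrand hf.1 hv.1
  have hi : Integrable (fun w : Cn n => Real.exp (0.94 * normSq w)) (gauss n) :=
    integrable_exp_mul_normSq (by norm_num)
  constructor
  · refine continuous_iff_continuousAt.2 fun x₀ => ?_
    have hev : ∀ᶠ x in nhds x₀, normSq x < normSq x₀ + 1 :=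
      continuous_normSq.continuousAt.eventually_lt_const (by linarith)
    refine continuousAt_of_dominated
      (bound := fun w => C * Real.exp (0.3 * (normSq x₀ + 1)) * Real.exp (0.94 * normSq w))
      (Filter.Eventually.of_forall fun x => ?_) ?_ (hi.const_mul _) (ae_of_all _ fun w => ?_)
    · exact (hcont.comp (continuous_const.prodMk continuous_id)).aestronglyMeasurable
    · filter_upwards [hev] with x hx
      refine ae_of_all _ fun w => (hb x w).trans ?_
      gcongr
    · exact (hcont.comp (continuous_id.prodMk continuous_const)).continuousAt
  · refine ⟨C * ∫ w : Cn n, Real.exp (0.94 * normSq w) ∂(gauss n),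
      mul_nonneg hC (integral_nonneg fun _ => (Real.exp_pos _).le), fun x => ?_⟩
    have := norm_integral_le_of_norm_le (hi.const_mul (C * Real.exp (0.3 * normSq x)))
      (ae_of_all _ (hb x))
    rw [integral_const_mul] at this
    rw [convSymbol]
    linarith

/-- With the `x` integral done first, $K(x,w)K(x,a)=K(x,w+a)$, so the conjugate reproducing formula
evaluates $\overline{v(x-w)}$ at $x=w+a$. The shift by $w$ cancels and $\overline{v(a)}$ comes out.
-/
theorem integral_convSymbol_mul_kernel_mul_kernel {n : ℕ} {f v : Cn n → ℂ} (hf : Entire f)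
    (hf' : ∀ c > 0, Growth c f) (hv : Entire v) (hv' : ∀ c > 0, Growth c v) (a z : Cn n) :
    ∫ x, convSymbol f v x * kernel x a * kernel z x ∂(gauss n)
      = f z * conj (v a) * kernel z a := by
  have hf1 := hf' 0.01 (by norm_num)
  have hv1 := hv' 0.01 (by norm_num)
  obtain ⟨C, hC, hb⟩ := norm_convSymbol_integrand_le hf1 hv1
  have hcont := continuous_convSymbol_integrand hf1.1 hv1.1
  have hK : Growth 0.2 fun x => kernel x a * kernel z x :=
    ((growth_kernel_left (c := 0.1) (by norm_num) a).mul
      (growth_kernel_right (c := 0.1) (by norm_num) z)).mono (by norm_num)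
  have hi : Integrable (fun w : Cn n => Real.exp (0.94 * normSq w)) (gauss n) :=
    integrable_exp_mul_normSq (by norm_num)
  have hprod : Integrable (fun p : Cn n × Cn n =>
      f p.2 * conj (v (p.1 - p.2)) * kernel p.1 p.2 * (kernel p.1 a * kernel z p.1))
      ((gauss n).prod (gauss n)) := by
    have hx := (((growth_exp_mul_normSq 0.3).mul hK).integrable (by norm_num)).norm.const_mul C
    refine (hx.mul_prod hi).mono' ?_ (ae_of_all _ fun p => ?_)
    · exact (hcont.mul (hK.1.comp continuous_fst)).aestronglyMeasurable
    · rw [norm_mul]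
      refine (mul_le_mul_of_nonneg_right (hb p.1 p.2) (norm_nonneg _)).trans (le_of_eq ?_)
      rw [norm_mul (Complex.ofReal _), Complex.norm_real, Real.norm_of_nonneg (Real.exp_pos _).le]
      ring
  have hswap := integral_integral_swap (f := fun x w : Cn n =>
      f w * conj (v (x - w)) * kernel x w * (kernel x a * kernel z x)) hprod
  have hl : ∀ x, ∫ w, f w * conj (v (x - w)) * kernel x w * (kernel x a * kernel z x) ∂(gauss n)
      = convSymbol f v x * kernel x a * kernel z x := fun x => by
    rw [integral_mul_const, convSymbol, mul_assoc]
  have hr : ∀ w, ∫ x, f w * conj (v (x - w)) * kernel x w * (kernel x a * kernel z x) ∂(gauss n)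
      = conj (v a) * kernel z a * (f w * kernel z w) := fun w => by
    have hd : Differentiable ℂ v := hv
    have h := integral_conj_mul_kernel_mul_kernel (g := fun x => v (x - w))
      (show Entire _ by unfold Entire; fun_prop)
      -- Translation doubles the growth exponent, hence `c / 2`.
      (fun c hc => ((hv' (c / 2) (by positivity)).comp_sub (by positivity) w).mono (by linarith))
      (w + a) z
    simp only [add_sub_cancel_left, kernel_add_right] at h
    calc _ = f w * ∫ x, conj (v (x - w)) * (kernel x w * kernel x a) * kernel z x ∂(gauss n) := by
          rw [← integral_const_mul]; congr 1; ext x; ring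
      _ = _ := by rw [h]; ring
  simp only [hl, hr, integral_const_mul] at hswap
  rw [hswap, integral_mul_kernel hf]
  · ring
  · exact (hf1.mul (growth_kernel_right (c := 0.1) (by norm_num) z)).integrable (by norm_num)

/-! ### Uniqueness of the symbol by Fourier analysis -/

/-- The finite measures $r^+\mu$ and $r^-\mu$ have the same characteristic function, so they
coincide. Then $r^+=r^-$ almost everywhere, which forces $r=0$. -/
theorem ae_eq_zero_of_integral_ofReal_mul_exp {E : Type*} [NormedAddCommGroup E]
    [NormedSpace ℝ E] [CompleteSpace E] [SecondCountableTopology E] [MeasurableSpace E]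
    [BorelSpace E] {μ : Measure E} {r : E → ℝ}
    (hr : Integrable r μ)
    (h : ∀ L : StrongDual ℝ E, ∫ x, (r x : ℂ) * Complex.exp (L x * Complex.I) ∂μ = 0) :
    r =ᵐ[μ] 0 := by
  have hm : ∀ {s : E → ℝ}, Integrable s μ → AEMeasurable (fun x => ENNReal.ofReal (s x)) μ :=
    fun hs => hs.aestronglyMeasurable.aemeasurable.ennreal_ofReal
  have hfin1 : IsFiniteMeasure (μ.withDensity fun x => ENNReal.ofReal (r x)) :=
    isFiniteMeasure_withDensity_ofReal hr.2
  have hfin2 : IsFiniteMeasure (μ.withDensity fun x => ENNReal.ofReal (-r x)) :=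
    isFiniteMeasure_withDensity_ofReal hr.neg.2
  have hexp : ∀ (L : StrongDual ℝ E) {s : E → ℝ}, Integrable s μ →
      Integrable (fun x => (s x : ℂ) * Complex.exp (L x * Complex.I)) μ := fun L s hs => by
    refine hs.ofReal.mul_bdd (c := 1) (Continuous.aestronglyMeasurable (by fun_prop))
      (ae_of_all _ fun x => ?_)
    rw [Complex.norm_exp_ofReal_mul_I]
  have hchar : ∀ (L : StrongDual ℝ E) {s : E → ℝ}, Integrable s μ →
      charFunDual (μ.withDensity fun x => ENNReal.ofReal (s x)) L
        = ∫ x, ((max (s x) 0 : ℝ) : ℂ) * Complex.exp (L x * Complex.I) ∂μ := fun L s hs => by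
    rw [charFunDual_apply, integral_withDensity_eq_integral_toReal_smul₀ (hm hs)
      (ae_of_all _ fun _ => ENNReal.ofReal_lt_top)]
    simp only [ENNReal.toReal_ofReal', Complex.real_smul]
  have hneg : Integrable (fun x => -r x) μ := hr.neg
  have heq : (μ.withDensity fun x => ENNReal.ofReal (r x))
      = μ.withDensity fun x => ENNReal.ofReal (-r x) := by
    refine Measure.ext_of_charFunDual (funext fun L => ?_)
    rw [hchar L hr, hchar L hneg, ← sub_eq_zero,
      ← integral_sub (hexp L hr.pos_part) (hexp L hneg.pos_part), ← h L]
    congr 1; ext x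
    rw [← sub_mul, ← Complex.ofReal_sub]
    congr 2
    rcases le_total 0 (r x) with hx | hx <;> simp [hx]
  have := (withDensity_eq_iff (hm hr) (hm hneg)
    (hr.lintegral_lt_top).ne).1 heq
  filter_upwards [this] with x hx
  rcases lt_trichotomy (r x) 0 with h0 | h0 | h0
  · rw [ENNReal.ofReal_of_nonpos h0.le] at hx
    have := ENNReal.ofReal_pos.2 (neg_pos.2 h0)
    exact absurd hx this.ne
  · exact h0
  · rw [ENNReal.ofReal_of_nonpos (neg_nonpos.2 h0.le)] at hx
    exact absurd hx (ENNReal.ofReal_pos.2 h0).ne'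

theorem ae_eq_zero_of_integral_mul_exp {E : Type*} [NormedAddCommGroup E]
    [NormedSpace ℝ E] [CompleteSpace E] [SecondCountableTopology E] [MeasurableSpace E]
    [BorelSpace E] {μ : Measure E} {d : E → ℂ}
    (hd : Integrable d μ)
    (h : ∀ L : StrongDual ℝ E, ∫ x, d x * Complex.exp (L x * Complex.I) ∂μ = 0) :
    d =ᵐ[μ] 0 := by
  have hexp : ∀ (L : StrongDual ℝ E) {s : E → ℂ}, Integrable s μ →
      Integrable (fun x => s x * Complex.exp (L x * Complex.I)) μ := fun L s hs => by
    refine hs.mul_bdd (c := 1) (Continuous.aestronglyMeasurable (by fun_prop))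
      (ae_of_all _ fun x => ?_)
    rw [Complex.norm_exp_ofReal_mul_I]
  have hdc : Integrable (fun x => conj (d x)) μ :=
    (LinearIsometryEquiv.integrable_comp_iff Complex.conjLIE).2 hd
  have hc : ∀ L : StrongDual ℝ E, ∫ x, conj (d x) * Complex.exp (L x * Complex.I) ∂μ = 0 :=
    fun L => by
      -- The hypothesis for $-L$, conjugated, covers $\overline d$, and hence the real and imaginary
      -- parts.
      have h1 := congrArg conj (h (-L))
      rw [← integral_conj, map_zero] at h1
      rw [← h1]
      congr 1; ext x
      rw [map_mul, ← Complex.exp_conj]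
      simp
  have hre := ae_eq_zero_of_integral_ofReal_mul_exp hd.re fun L => by
    have : ∀ x, ((RCLike.re (d x) : ℝ) : ℂ) * Complex.exp (L x * Complex.I)
        = (1 / 2) * (d x * Complex.exp (L x * Complex.I)
          + conj (d x) * Complex.exp (L x * Complex.I)) := fun x => by
      have := Complex.re_eq_add_conj (d x)
      simp only [RCLike.re_to_complex]
      rw [this]; ring
    simp only [this]
    rw [integral_const_mul, integral_add (hexp L hd) (hexp L hdc), h, hc]
    simp
  have him := ae_eq_zero_of_integral_ofReal_mul_exp hd.im fun L => by
    have : ∀ x, ((RCLike.im (d x) : ℝ) : ℂ) * Complex.exp (L x * Complex.I)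
        = (1 / (2 * Complex.I)) * (d x * Complex.exp (L x * Complex.I)
          - conj (d x) * Complex.exp (L x * Complex.I)) := fun x => by
      have := Complex.im_eq_sub_conj (d x)
      simp only [RCLike.im_to_complex]
      rw [this]; ring
    simp only [this]
    rw [integral_const_mul, integral_sub (hexp L hd) (hexp L hdc), h, hc]
    simp
  filter_upwards [hre, him] with x h1 h2
  exact Complex.ext h1 h2

/-- The product is $e^{x\cdot\overline a-a\cdot\overline x}=e^{2i\,\mathrm{Im}(x\cdot\overline a)}$,
and every real functional has the form $2\,\mathrm{Im}(x\cdot\overline a)$. -/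
theorem exists_kernel_mul_kernel_eq_exp {n : ℕ} (L : StrongDual ℝ (Cn n)) :
    ∃ a : Cn n, ∀ x, kernel x a * kernel (-a) x = Complex.exp (L x * Complex.I) := by
  refine ⟨fun j => ⟨L (Pi.single j Complex.I) / 2, -L (Pi.single j 1) / 2⟩, fun x => ?_⟩
  have hL : L x = ∑ j, ((x j).re * L (Pi.single j 1) + (x j).im * L (Pi.single j Complex.I)) := by
    conv_lhs => rw [← Finset.univ_sum_single x]
    rw [map_sum]
    refine Finset.sum_congr rfl fun j _ => ?_
    have : (Pi.single j (x j) : Cn n)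
        = (x j).re • (Pi.single j 1 : Cn n) + (x j).im • (Pi.single j Complex.I : Cn n) := by
      rw [← Pi.single_smul, ← Pi.single_smul, ← Pi.single_add]
      congr 1
      apply Complex.ext <;> simp
    rw [this, map_add, map_smul, map_smul, smul_eq_mul, smul_eq_mul]
  rw [kernel, kernel, ← Complex.exp_add, hL, dotConj, dotConj, Complex.ofReal_sum,
    Finset.sum_mul, ← Finset.sum_add_distrib]
  congr 1
  refine Finset.sum_congr rfl fun j _ => ?_
  apply Complex.ext
  · simp; ring
  · simp; ring

theorem ae_eq_zero_of_integral_mul_kernel_mul_kernel {n : ℕ} {d : Cn n → ℂ}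
    (hd : Integrable d (gauss n))
    (h : ∀ a z, ∫ x, d x * kernel x a * kernel z x ∂(gauss n) = 0) : d =ᵐ[gauss n] 0 := by
  refine ae_eq_zero_of_integral_mul_exp hd fun L => ?_
  obtain ⟨a, ha⟩ := exists_kernel_mul_kernel_eq_exp L
  rw [← h a (-a)]
  simp only [mul_assoc, ha]

/-! ### Derivatives as integrals against the kernel -/

/-- Continuous functions of the symbol class. -/
def Slow {n : ℕ} (F : Cn n → ℂ) : Prop := ∀ c > 0, Growth c F

theorem Slow.mul {n : ℕ} {F G : Cn n → ℂ} (hF : Slow F) (hG : Slow G) :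
    Slow fun x => F x * G x := fun c hc =>
  ((hF (c / 2) (by positivity)).mul (hG (c / 2) (by positivity))).mono (by linarith)

theorem slow_const {n : ℕ} (a : ℂ) : Slow fun _ : Cn n => a := fun _ hc => Growth.const hc.le a

theorem Slow.pow {n : ℕ} {F : Cn n → ℂ} (hF : Slow F) (m : ℕ) : Slow fun x => F x ^ m := by
  induction m with
  | zero => simpa using slow_const 1
  | succ m ih => simpa only [pow_succ] using ih.mul hF

theorem growth_sum_norm {n : ℕ} {c : ℝ} (hc : 0 < c) :
    Growth c fun w : Cn n => ((∑ j, ‖w j‖ : ℝ) : ℂ) := by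
  refine ⟨by fun_prop, n + 1 / c, by positivity, fun w => ?_⟩
  have h0 := normSq_nonneg w
  have h1 : ∑ j, ‖w j‖ ≤ n + normSq w := by
    have : (n : ℝ) + normSq w = ∑ j, (1 + ‖w j‖ ^ 2) := by
      simp [Finset.sum_add_distrib, normSq]
    rw [this]
    refine Finset.sum_le_sum fun j _ => ?_
    nlinarith [sq_nonneg (‖w j‖ - 1), norm_nonneg (w j)]
  have h2 := Real.add_one_le_exp (c * normSq w)
  have h3 : normSq w ≤ 1 / c * Real.exp (c * normSq w) := by
    rw [one_div, ← div_eq_inv_mul, le_div_iff₀ hc]; linarith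
  have h4 : (n : ℝ) ≤ n * Real.exp (c * normSq w) :=
    le_mul_of_one_le_right (Nat.cast_nonneg n) (Real.one_le_exp (by positivity))
  rw [Complex.norm_real, Real.norm_of_nonneg (Finset.sum_nonneg fun _ _ => norm_nonneg _), add_mul]
  linarith

theorem slow_conj_coord {n : ℕ} (j : Fin n) : Slow fun w : Cn n => conj (w j) := fun c hc => by
  obtain ⟨-, C, hC, h⟩ := growth_sum_norm (n := n) hc
  refine ⟨Complex.continuous_conj.comp (continuous_apply j), C, hC, fun w => le_trans ?_ (h w)⟩
  rw [RCLike.norm_conj, Complex.norm_real,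
    Real.norm_of_nonneg (Finset.sum_nonneg fun _ _ => norm_nonneg _)]
  exact Finset.single_le_sum (f := fun j => ‖w j‖) (fun _ _ => norm_nonneg _) (Finset.mem_univ j)

/-- Differentiation under the integral sign: $\partial_{z_j}e^{z\cdot\overline
w}=\overline{w_j}e^{z\cdot\overline w}$. The weight $b=2.5$ leaves only $1/(4b)=0.1$ in `w`,
uniformly for $z$ in a neighbourhood. -/
theorem pderiv_proj {n : ℕ} {B : Cn n → ℂ} (hB : Slow B) (j : Fin n) :
    pderiv j (proj B) = proj fun w => B w * conj (w j) := by
  funext z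
  let M : Cn n → (Cn n →L[ℂ] ℂ) := fun w => ∑ i, conj (w i) • ContinuousLinearMap.proj i
  have hMapp : ∀ w h, M w h = dotConj h w := fun w h => by
    simp [M, dotConj, mul_comm]
  have hMnorm : ∀ w, ‖M w‖ ≤ ∑ i, ‖w i‖ := fun w => by
    refine ContinuousLinearMap.opNorm_le_bound _ (Finset.sum_nonneg fun _ _ => norm_nonneg _)
      fun h => ?_
    rw [hMapp, dotConj, Finset.sum_mul]
    refine (norm_sum_le _ _).trans (Finset.sum_le_sum fun i _ => ?_)
    rw [norm_mul, RCLike.norm_conj, mul_comm]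
    exact mul_le_mul_of_nonneg_left (norm_le_pi_norm h i) (norm_nonneg _)
  have hMcont : Continuous M := by
    have : Continuous (fun x : ℂ => conj x) := Complex.continuous_conj
    fun_prop
  have hB1 := hB 0.1 (by norm_num)
  have hcont : ∀ x, Continuous fun w => B w * kernel x w := fun x =>
    hB1.1.mul (growth_kernel_right (c := 1) one_pos x).1
  have hbound := (hB1.mul ((growth_sum_norm (n := n) (c := 0.1) (by norm_num)).mul
    (growth_exp_mul_normSq 0.1))).integrable (by norm_num)
  have hs : {x : Cn n | normSq x < normSq z + 1} ∈ nhds z :=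
    continuous_normSq.continuousAt.eventually_lt_const (by linarith)
  have hle : ∀ w, ∀ x ∈ {x : Cn n | normSq x < normSq z + 1}, ‖(B w * kernel x w) • M w‖
      ≤ Real.exp (2.5 * (normSq z + 1)) *
        ‖B w * (((∑ j, ‖w j‖ : ℝ) : ℂ) * ((Real.exp (0.1 * normSq w) : ℝ) : ℂ))‖ :=
    fun w x hx => by
      have hK : ‖kernel x w‖
          ≤ Real.exp (2.5 * (normSq z + 1)) * Real.exp (0.1 * normSq w) := by
        refine (norm_kernel_le (b := 2.5) (by norm_num) x w).trans ?_
        rw [← Real.exp_add]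
        refine Real.exp_le_exp.2 ?_
        have : normSq x < normSq z + 1 := hx
        norm_num at *
        linarith
      rw [norm_smul, norm_mul, norm_mul, norm_mul, Complex.norm_real, Complex.norm_real,
        Real.norm_of_nonneg (Finset.sum_nonneg fun _ _ => norm_nonneg _),
        Real.norm_of_nonneg (Real.exp_pos _).le]
      calc ‖B w‖ * ‖kernel x w‖ * ‖M w‖
          ≤ ‖B w‖ * (Real.exp (2.5 * (normSq z + 1)) * Real.exp (0.1 * normSq w))
            * ∑ j, ‖w j‖ := by
            gcongr
            exact hMnorm w
        _ = _ := by ring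
  have hder := hasFDerivAt_integral_of_dominated_of_fderiv_le (𝕜 := ℂ) (μ := gauss n)
    (F := fun x w => B w * kernel x w) (F' := fun x w => (B w * kernel x w) • M w)
    (bound := fun w => Real.exp (2.5 * (normSq z + 1)) *
      ‖B w * (((∑ j, ‖w j‖ : ℝ) : ℂ) * ((Real.exp (0.1 * normSq w) : ℝ) : ℂ))‖)
    hs (Filter.Eventually.of_forall fun x => (hcont x).aestronglyMeasurable)
    ((hB1.mul (growth_kernel_right (c := 0.1) (by norm_num) z)).integrable (by norm_num))
    ((hcont z).smul hMcont).aestronglyMeasurable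
    (ae_of_all _ hle) (hbound.norm.const_mul _) (ae_of_all _ fun w x _ => ?_)
  · have hint : Integrable (fun w => (B w * kernel z w) • M w) (gauss n) := by
      refine (hbound.norm.const_mul (Real.exp (2.5 * (normSq z + 1)))).mono'
        ((hcont z).smul hMcont).aestronglyMeasurable (ae_of_all _ fun w => ?_)
      exact hle w z (by simp)
    rw [pderiv]
    have : (proj B) = fun x => ∫ w, B w * kernel x w ∂(gauss n) := rfl
    rw [this, hder.fderiv, ContinuousLinearMap.integral_apply hint, proj]
    congr 1; ext w
    have h1 : dotConj (Pi.single j 1) w = conj (w j) := by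
      simp [dotConj, Pi.single_apply]
    rw [_root_.smul_apply, hMapp, h1, smul_eq_mul]
    ring
  · have h1 : HasFDerivAt (fun x => dotConj x w) (M w) x := by
      have := (M w).hasFDerivAt (x := x)
      exact this.congr_of_eventuallyEq (Filter.Eventually.of_forall fun y => (hMapp w y).symm)
    have h2 := (h1.cexp).const_mul (B w)
    rw [smul_smul] at h2
    exact h2

theorem iterate_pderiv_proj {n : ℕ} {B : Cn n → ℂ} (hB : Slow B) (j : Fin n) (m : ℕ) :
    (pderiv j)^[m] (proj B) = proj fun w => B w * conj (w j) ^ m := by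
  induction m with
  | zero => simp
  | succ m ih =>
    rw [Function.iterate_succ_apply', ih, pderiv_proj (hB.mul ((slow_conj_coord j).pow m))]
    simp only [pow_succ, mul_assoc]

theorem slow_prod_conj {n : ℕ} (i : Fin n → ℕ) : Slow fun w : Cn n => ∏ j, conj (w j) ^ i j := by
  classical
  have : ∀ s : Finset (Fin n), Slow fun w : Cn n => ∏ j ∈ s, conj (w j) ^ i j := fun s => by
    induction s using Finset.induction_on with
    | empty => simpa using slow_const 1
    | insert a s ha ih =>
      simp only [Finset.prod_insert ha]
      exact ((slow_conj_coord a).pow _).mul ih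
  exact this _

theorem multiDeriv_proj {n : ℕ} {B : Cn n → ℂ} (hB : Slow B) (i : Fin n → ℕ) :
    multiDeriv i (proj B) = proj fun w => B w * ∏ j, conj (w j) ^ i j := by
  have h : ∀ l : List (Fin n),
      (Slow fun w : Cn n => B w * (l.map fun j => conj (w j) ^ i j).prod) ∧
      l.foldr (fun j F => (pderiv j)^[i j] F) (proj B)
        = proj fun w => B w * (l.map fun j => conj (w j) ^ i j).prod := fun l => by
    induction l with
    | nil => simpa using hB
    | cons a l ih =>
      have h1 : ∀ w : Cn n, B w * ((a :: l).map fun j => conj (w j) ^ i j).prod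
          = B w * (l.map fun j => conj (w j) ^ i j).prod * conj (w a) ^ i a := fun w => by
        rw [List.map_cons, List.prod_cons]; ring
      simp only [h1]
      refine ⟨ih.1.mul ((slow_conj_coord a).pow _), ?_⟩
      rw [List.foldr_cons, ih.2, iterate_pderiv_proj ih.1]
  rw [multiDeriv, (h _).2]
  simp only [Fin.prod_univ_def]

theorem proj_eq_self {n : ℕ} {F : Cn n → ℂ} (hF : Entire F) (hF' : Slow F) : proj F = F :=
  funext fun z => integral_mul_kernel hF z
    (((hF' 0.1 (by norm_num)).mul (growth_kernel_right (c := 0.1) (by norm_num) z)).integrable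
      (by norm_num))

theorem multiDeriv_eq {n : ℕ} {F : Cn n → ℂ} (hF : Entire F) (hF' : Slow F) (i : Fin n → ℕ)
    (z : Cn n) :
    multiDeriv i F z = ∫ w, F w * (∏ j, conj (w j) ^ i j) * kernel z w ∂(gauss n) := by
  have h := multiDeriv_proj hF' i
  rw [proj_eq_self hF hF'] at h
  rw [h, proj]

theorem sum_Iic_prod_choose {n : ℕ} (x y : Fin n → ℂ) (i : Fin n → ℕ) :
    ∑ l ∈ Finset.Iic i, (∏ j, ((i j).choose (l j) : ℂ)) * (∏ j, x j ^ l j) *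
      (-1) ^ (∑ j, (i j - l j)) * ∏ j, y j ^ (i - l) j = ∏ j, (x j - y j) ^ i j := by
  have h : ∀ j, (x j - y j) ^ i j = ∑ m ∈ Finset.Iic (i j),
      ((i j).choose m : ℂ) * x j ^ m * (-1) ^ (i j - m) * y j ^ (i j - m) := fun j => by
    have : Finset.Iic (i j) = Finset.range (i j + 1) := by ext; simp
    rw [sub_eq_add_neg, add_pow, this]
    refine Finset.sum_congr rfl fun m _ => ?_
    rw [neg_pow (y j)]; ring
  simp only [h]
  rw [Finset.prod_univ_sum]
  refine Finset.sum_congr rfl fun l _ => ?_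
  simp only [Finset.prod_mul_distrib, Finset.prod_pow_eq_pow_sum, Pi.sub_apply]

/-- Under the integral $\partial^m$ becomes multiplication by $\overline w^m$, so the binomial
theorem collapses the sum. -/
theorem conjSubDerivPow_eq {n : ℕ} {f : Cn n → ℂ} (hf : Entire f) (hf' : Slow f)
    (i : Fin n → ℕ) (z : Cn n) :
    conjSubDerivPow i f z
      = ∫ w, f w * (∏ j, (conj (z j) - conj (w j)) ^ i j) * kernel z w ∂(gauss n) := by
  have hi : ∀ m : Fin n → ℕ,
      Integrable (fun w => f w * (∏ j, conj (w j) ^ m j) * kernel z w) (gauss n) := fun m =>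
    (((hf'.mul (slow_prod_conj m)) 0.1 (by norm_num)).mul
      (growth_kernel_right (c := 0.1) (by norm_num) z)).integrable (by norm_num)
  rw [conjSubDerivPow]
  simp only [multiDeriv_eq hf hf', ← integral_const_mul]
  rw [← integral_finsetSum _ fun l _ => (hi _).const_mul _]
  congr 1; ext w
  rw [← sum_Iic_prod_choose, Finset.mul_sum, Finset.sum_mul]
  refine Finset.sum_congr rfl fun l _ => ?_
  ring

/-! ### Multivariable Taylor series and $v^*(\overline z-\partial_z)f$ -/

theorem hasSum_prod_pi_of_summable_norm {R : Type*} [NormedField R] [CompleteSpace R] :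
    ∀ {n : ℕ} {f : Fin n → ℕ → R}, (∀ j, Summable fun m => ‖f j m‖) →
      (Summable fun i : Fin n → ℕ => ‖∏ j, f j (i j)‖) ∧
      HasSum (fun i : Fin n → ℕ => ∏ j, f j (i j)) (∏ j, ∑' m, f j m) := by
  intro n
  induction n with
  | zero =>
    intro f _
    refine ⟨(hasSum_unique _).summable, ?_⟩
    simp
  | succ n ih =>
    intro f hf
    obtain ⟨h1, h2⟩ := ih (f := fun j => f j.succ) fun j => hf j.succ
    obtain ⟨F, hF⟩ : ∃ F : (Fin n → ℕ) → R, F = fun i => ∏ j : Fin n, f j.succ (i j) := ⟨_, rfl⟩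
    obtain ⟨t, ht⟩ : ∃ t : R, t = ∏ j : Fin n, ∑' m, f j.succ m := ⟨_, rfl⟩
    have hF1 : Summable fun i => ‖F i‖ := by rw [hF]; exact h1
    have hF2 : HasSum F t := by rw [hF, ht]; exact h2
    let e : ℕ × (Fin n → ℕ) ≃ (Fin (n + 1) → ℕ) := Fin.consEquiv fun _ => ℕ
    have he : (fun i : Fin (n + 1) → ℕ => ∏ j, f j (i j)) ∘ e
        = fun p => f 0 p.1 * F p.2 := funext fun p => by
      rw [hF]; exact Fin.prod_univ_succ _
    constructor
    · rw [← e.summable_iff]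
      exact ((hf 0).mul_norm hF1).congr fun p => congrArg norm (congrFun he p).symm
    · rw [← e.hasSum_iff, he, Fin.prod_univ_succ, ← ht]
      exact (hf 0).of_norm.hasSum.mul hF2 ((hf 0).mul_norm hF1).of_norm

theorem hasSum_prod_pow_div_factorial {n : ℕ} (t : Fin n → ℂ) :
    HasSum (fun i : Fin n → ℕ => ∏ j, t j ^ i j / ((i j).factorial : ℂ))
      (Complex.exp (∑ j, t j)) := by
  have h := (hasSum_prod_pi_of_summable_norm (f := fun j m => t j ^ m / (m.factorial : ℂ))
    fun j => NormedSpace.norm_expSeries_div_summable (t j)).2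
  have he : ∏ j, ∑' m, t j ^ m / (m.factorial : ℂ) = Complex.exp (∑ j, t j) := by
    rw [Complex.exp_sum, Complex.exp_eq_exp_ℂ]
    simp only [NormedSpace.exp_eq_tsum_div]
  rwa [he] at h

theorem sum_norm_prod_pow_div_factorial_le {n : ℕ} (t : Fin n → ℂ) (s : Finset (Fin n → ℕ)) :
    ∑ i ∈ s, ‖∏ j, t j ^ i j / ((i j).factorial : ℂ)‖ ≤ Real.exp (∑ j, ‖t j‖) := by
  have h := (hasSum_prod_pi_of_summable_norm (f := fun j m => ‖t j‖ ^ m / (m.factorial : ℝ))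
    fun j => NormedSpace.norm_expSeries_div_summable (‖t j‖)).2
  have he : ∏ j, ∑' m, ‖t j‖ ^ m / (m.factorial : ℝ) = Real.exp (∑ j, ‖t j‖) := by
    rw [Real.exp_sum, Real.exp_eq_exp_ℝ]
    simp only [NormedSpace.exp_eq_tsum_div]
  rw [he] at h
  refine le_trans (le_of_eq (Finset.sum_congr rfl fun i _ => ?_))
    (sum_le_hasSum s (fun i _ => Finset.prod_nonneg fun j _ => by positivity) h)
  simp [norm_prod]

theorem taylorCoeff_mul_prod {n : ℕ} {F : Cn n → ℂ} (hF : Entire F) (hF' : Slow F)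
    (i : Fin n → ℕ) (t : Cn n) :
    taylorCoeff F i * ∏ j, t j ^ i j
      = ∫ w, F w * ∏ j, (t j * conj (w j)) ^ i j / ((i j).factorial : ℂ) ∂(gauss n) := by
  rw [taylorCoeff, multiDeriv_eq hF hF', ← integral_div, ← integral_mul_const]
  congr 1; ext w
  rw [kernel_zero_left, Finset.prod_div_distrib]
  simp only [mul_pow, Finset.prod_mul_distrib]
  ring

theorem integrable_taylor_term {n : ℕ} {F : Cn n → ℂ} (hF : Slow F) (i : Fin n → ℕ) (t : Cn n) :
    Integrable (fun w => F w * ∏ j, (t j * conj (w j)) ^ i j / ((i j).factorial : ℂ))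
      (gauss n) := by
  have h := (((hF.mul (slow_prod_conj i)) 0.1 (by norm_num)).integrable (by norm_num)).const_mul
    (∏ j, t j ^ i j / ((i j).factorial : ℂ))
  refine h.congr (ae_of_all _ fun w => ?_)
  simp only [mul_pow, Finset.prod_mul_distrib, Finset.prod_div_distrib]
  ring

/-- The series is dominated by $|F(w)|e^{\sum|t_j||w_j|}$. The Gaussian bound in `t` is uniform over
finite sets, so it survives the later substitution $t=\overline{z-w}$ and integration in `w`. -/
theorem exists_sum_integral_norm_taylor_le {n : ℕ} {F : Cn n → ℂ} (hF : Slow F) :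
    ∃ C : ℝ, 0 ≤ C ∧ ∀ (t : Cn n) (s : Finset (Fin n → ℕ)),
      ∑ i ∈ s, ∫ w, ‖F w * ∏ j, (t j * conj (w j)) ^ i j / ((i j).factorial : ℂ)‖ ∂(gauss n)
        ≤ C * Real.exp (0.28 * normSq t) := by
  have hi := (((hF 0.01 (by norm_num)).mul (growth_exp_mul_normSq (n := n) 0.9)).integrable
    (by norm_num)).norm
  refine ⟨∫ w, ‖F w * ((Real.exp (0.9 * normSq w) : ℝ) : ℂ)‖ ∂(gauss n),
    integral_nonneg fun _ => norm_nonneg _, fun t s => ?_⟩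
  have hterm := fun i : Fin n → ℕ => integrable_taylor_term hF i t
  rw [← integral_finsetSum _ fun i _ => (hterm i).norm, ← integral_mul_const]
  refine integral_mono (integrable_finsetSum _ fun i _ => (hterm i).norm) (hi.mul_const _)
    fun w => ?_
  have h1 := sum_norm_prod_pow_div_factorial_le (fun j => t j * conj (w j)) s
  have h2 := sum_norm_mul_norm_le (b := 0.28) (by norm_num) t w
  simp only [norm_mul, RCLike.norm_conj] at h1
  have h3 : Real.exp (∑ j, ‖t j‖ * ‖w j‖)
      ≤ Real.exp (0.9 * normSq w) * Real.exp (0.28 * normSq t) := by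
    rw [← Real.exp_add]
    refine Real.exp_le_exp.2 (h2.trans ?_)
    have := normSq_nonneg w
    norm_num
    linarith
  simp only [norm_mul, ← Finset.mul_sum, Complex.norm_real,
    Real.norm_of_nonneg (Real.exp_pos _).le]
  rw [mul_assoc]
  exact mul_le_mul_of_nonneg_left (h1.trans h3) (norm_nonneg _)

theorem exists_sum_norm_taylorCoeff_le {n : ℕ} {F : Cn n → ℂ} (hF : Entire F) (hF' : Slow F) :
    ∃ C : ℝ, 0 ≤ C ∧ ∀ (t : Cn n) (s : Finset (Fin n → ℕ)),
      ∑ i ∈ s, ‖taylorCoeff F i * ∏ j, t j ^ i j‖ ≤ C * Real.exp (0.28 * normSq t) := by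
  obtain ⟨C, hC, h⟩ := exists_sum_integral_norm_taylor_le hF'
  refine ⟨C, hC, fun t s => (Finset.sum_le_sum fun i _ => ?_).trans (h t s)⟩
  rw [taylorCoeff_mul_prod hF hF']
  exact norm_integral_le_integral_norm _

theorem hasSum_taylor {n : ℕ} {F : Cn n → ℂ} (hF : Entire F) (hF' : Slow F) (t : Cn n) :
    HasSum (fun i => taylorCoeff F i * ∏ j, t j ^ i j) (F t) := by
  obtain ⟨C, -, hC⟩ := exists_sum_integral_norm_taylor_le hF'
  simp only [taylorCoeff_mul_prod hF hF']
  have h := hasSum_integral_of_summable_integral_norm (fun i => integrable_taylor_term hF' i t)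
    (summable_of_sum_le (fun i => integral_nonneg fun _ => norm_nonneg _) (hC t))
  have hsum : ∀ w, ∑' i : Fin n → ℕ, F w * ∏ j, (t j * conj (w j)) ^ i j / ((i j).factorial : ℂ)
      = F w * kernel t w := fun w =>
    ((hasSum_prod_pow_div_factorial fun j => t j * conj (w j)).mul_left (F w)).tsum_eq
  simp only [hsum] at h
  have hp := congrFun (proj_eq_self hF hF') t
  rw [proj] at hp
  rwa [hp] at h

/-- Termwise integration of the Taylor series of `F` at $\overline{z-w}$. Absolute convergence holds
because $0.28|z-w|^2\le0.56|z|^2+0.56|w|^2$, and $0.56$ plus the growth $0.2$ of $f(w)K(z,w)$ is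
below $1$. -/
theorem hasSum_conjSubDerivTerm {n : ℕ} {F f : Cn n → ℂ} (hF : Entire F) (hF' : Slow F)
    (hf : Entire f) (hf' : Slow f) (z : Cn n) :
    HasSum (conjSubDerivTerm F f z)
      (∫ w, f w * F (fun j => conj ((z - w) j)) * kernel z w ∂(gauss n)) := by
  obtain ⟨C, hC, hb⟩ := exists_sum_norm_taylorCoeff_le hF hF'
  have hfK := (hf' 0.1 (by norm_num)).mul (growth_kernel_right (c := 0.1) (by norm_num) z)
  let Φ : (Fin n → ℕ) → Cn n → ℂ := fun i w =>
    f w * kernel z w * (taylorCoeff F i * ∏ j, conj ((z - w) j) ^ i j)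
  have hΦ : ∀ i, ∫ w, Φ i w ∂(gauss n) = conjSubDerivTerm F f z i := fun i => by
    rw [conjSubDerivTerm, conjSubDerivPow_eq hf hf', ← integral_const_mul]
    congr 1; ext w
    simp only [Φ, Pi.sub_apply, map_sub]
    ring
  have hΦi : ∀ i, Integrable (Φ i) (gauss n) := fun i => by
    -- This bounds monomials in $w-z$; the sign $(-1)^{|i|}$ passes to $z-w$.
    have h := ((slow_prod_conj (n := n) i) 0.1 (by norm_num)).comp_sub (by norm_num) z
    have h2 := ((hfK.mul h).integrable (by norm_num)).const_mul
      (taylorCoeff F i * ∏ j : Fin n, (-1) ^ i j)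
    refine h2.congr (ae_of_all _ fun w => ?_)
    have h3 : ∏ j, conj ((z - w) j) ^ i j
        = (∏ j : Fin n, (-1) ^ i j) * ∏ j, conj ((w - z) j) ^ i j := by
      rw [← Finset.prod_mul_distrib]
      refine Finset.prod_congr rfl fun j _ => ?_
      rw [← mul_pow]
      simp
    simp only [Φ, h3]
    ring
  have hbound := (hfK.mul (growth_exp_mul_normSq (n := n) 0.56)).integrable (by norm_num)
  have hsum : Summable fun i => ∫ w, ‖Φ i w‖ ∂(gauss n) := by
    refine summable_of_sum_le (c := ∫ w, ‖f w * kernel z w *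
      ((Real.exp (0.56 * normSq w) : ℝ) : ℂ)‖ * (C * Real.exp (0.56 * normSq z)) ∂(gauss n))
      (fun i => integral_nonneg fun _ => norm_nonneg _) fun s => ?_
    rw [← integral_finsetSum _ fun i _ => (hΦi i).norm]
    refine integral_mono (integrable_finsetSum _ fun i _ => (hΦi i).norm)
      (hbound.norm.mul_const _) fun w => ?_
    have h1 := hb (fun j => conj ((z - w) j)) s
    have h2 : normSq (fun j => conj ((z - w) j)) = normSq (z - w) := by
      simp only [normSq, RCLike.norm_conj]
    rw [h2] at h1
    have h3 : Real.exp (0.28 * normSq (z - w))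
        ≤ Real.exp (0.56 * normSq w) * Real.exp (0.56 * normSq z) := by
      rw [← Real.exp_add]
      refine Real.exp_le_exp.2 ?_
      have := normSq_sub_le z w
      linarith
    simp only [Φ, norm_mul (f w * kernel z w), ← Finset.mul_sum]
    calc _ ≤ ‖f w * kernel z w‖ * (C * Real.exp (0.28 * normSq (z - w))) := by gcongr
      _ ≤ ‖f w * kernel z w‖ * (C * (Real.exp (0.56 * normSq w) * Real.exp (0.56 * normSq z))) := by
          gcongr
      _ = _ := by
          rw [Complex.norm_real, Real.norm_of_nonneg (Real.exp_pos _).le]; ring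
  have h := hasSum_integral_of_summable_integral_norm hΦi hsum
  simp only [hΦ] at h
  have hpt : ∀ w, ∑' i, Φ i w = f w * F (fun j => conj ((z - w) j)) * kernel z w := fun w => by
    simp only [Φ]
    rw [((hasSum_taylor hF hF' fun j => conj ((z - w) j)).mul_left _).tsum_eq]
    ring
  simpa only [hpt] using h

theorem entire_conjStar {n : ℕ} {v : Cn n → ℂ} (hv : Entire v) : Entire (conjStar v) :=
  fun z => by
    have h := (hv (star z)).star_star
    rw [star_star] at h
    exact h

theorem slow_conjStar {n : ℕ} {v : Cn n → ℂ} (hv : Slow v) : Slow (conjStar v) := fun c hc => by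
  obtain ⟨hd, C, hC, h⟩ := hv c hc
  have hstar : Continuous fun (z : Cn n) (j : Fin n) => conj (z j) :=
    continuous_pi fun j => Complex.continuous_conj.comp (continuous_apply j)
  refine ⟨Complex.continuous_conj.comp (hd.comp hstar), C, hC, fun x => ?_⟩
  have h2 : normSq (fun j => conj (x j)) = normSq x := by simp [normSq]
  rw [conjStar, RCLike.norm_conj, ← h2]
  exact h _

theorem hasSum_conjSubDerivTerm_conjStar {n : ℕ} {f v : Cn n → ℂ} (hf : Entire f) (hf' : Slow f)
    (hv : Entire v) (hv' : Slow v) (z : Cn n) :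
    HasSum (conjSubDerivTerm (conjStar v) f z) (convSymbol f v z) := by
  have h := hasSum_conjSubDerivTerm (entire_conjStar hv) (slow_conjStar hv') hf hf' z
  simp only [conjStar, Complex.conj_conj] at h
  exact h

/-! ### Domains, and the product as a Toeplitz operator -/

theorem slow_of_inSym {n : ℕ} {f : Cn n → ℂ} (hf : InSym f ∧ Entire f) : Slow f :=
  fun _ hc => growth_of_inSym hf hc

theorem Slow.add {n : ℕ} {F G : Cn n → ℂ} (hF : Slow F) (hG : Slow G) :
    Slow fun x => F x + G x := fun c hc => (hF c hc).add (hG c hc)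

theorem Slow.conj {n : ℕ} {F : Cn n → ℂ} (hF : Slow F) : Slow fun x => conj (F x) :=
  fun c hc => (hF c hc).conj

theorem slow_kernel_left {n : ℕ} (a : Cn n) : Slow fun x => kernel x a :=
  fun _ hc => growth_kernel_left hc a

theorem slow_kernel_right {n : ℕ} (z : Cn n) : Slow fun x => kernel z x :=
  fun _ hc => growth_kernel_right hc z

theorem Slow.inFock {n : ℕ} {k : Cn n → ℂ} (hk : Slow k) (hk' : Entire k) : InFock k :=
  inFock_of_growth hk' (hk 0.1 (by norm_num)) (by norm_num)

theorem inFock_kernel {n : ℕ} (a : Cn n) : InFock fun x => kernel x a :=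
  (slow_kernel_left a).inFock (entire_kernel a)

theorem inDom_of_slow {n : ℕ} {φ k : Cn n → ℂ} (hφ : Slow φ) (hk : Slow k) (hk' : Entire k) :
    InDom φ k :=
  ⟨hk.inFock hk', fun z => (((hφ.mul hk).mul (slow_kernel_right z)) 0.1 (by norm_num)).integrable
    (by norm_num)⟩

theorem inDomMul_kernel {n : ℕ} {u v φ ψ : Cn n → ℂ} (hφ : Slow φ) (hψ : Slow ψ)
    (hu : Entire u) (hu' : Slow u) (hv : Entire v) (hv' : Slow v)
    (h : ∀ z, ψ z = u z + conj (v z)) (a : Cn n) : InDomMul φ ψ fun w => kernel w a := by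
  refine ⟨inDom_of_slow hψ (slow_kernel_left a) (entire_kernel a), ?_⟩
  have heq : toeplitz ψ (fun w => kernel w a) = fun z => (u z + conj (v a)) * kernel z a :=
    funext fun z => toeplitz_kernel hu hu' hv hv' h a z
  rw [heq]
  refine inDom_of_slow hφ ((hu'.add (slow_const _)).mul (slow_kernel_left a)) ?_
  exact (Differentiable.add_const _ hu).mul (entire_kernel a)

theorem inDom_kernel_of_memLp {n : ℕ} {h : Cn n → ℂ} (hh : MemLp h 2 (gauss n)) (a : Cn n) :
    InDom h fun w => kernel w a := by
  refine ⟨inFock_kernel a, fun z => ?_⟩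
  have h1 := ((slow_kernel_left a).mul (slow_kernel_right z) 0.1 (by norm_num)).memLp (by norm_num)
  simp only [mul_assoc]
  exact hh.integrable_mul h1

/-- A functional of moderate growth that annihilates the reproducing kernels annihilates `F²`. -/
theorem integral_mul_eq_zero_of_kernel {n : ℕ} {c : ℝ} {A : Cn n → ℂ} (hA : Growth c A)
    (hc : c < 0.4) (h : ∀ a, ∫ x, A x * kernel x a ∂(gauss n) = 0) {k : Cn n → ℂ}
    (hk : InFock k) : ∫ x, A x * k x ∂(gauss n) = 0 := by
  -- The function $k$ is the superposition of the kernels $K_a$ with weights $k(a)$; Fubini moves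
  -- the functional onto each $K_a$.
  have hrep : ∀ x, ∫ a, k a * kernel x a ∂(gauss n) = k x := fun x => by
    refine integral_mul_kernel hk.1 x ?_
    simpa only [mul_comm] using integrable_mul_of_inFock hk
      (growth_kernel_right (c := 0.1) (by norm_num) x) (by norm_num)
  have := integral_integral_kernel_swap hA hc hk.1.continuous
    (integrable_mul_of_inFock hk (growth_exp_mul_normSq 0.42) (by norm_num))
  simpa only [hrep, h, mul_zero, integral_zero] using this

theorem productSymbol_eq {n : ℕ} {f g u v : Cn n → ℂ} (hf : Entire f) (hf' : Slow f)
    (hv : Entire v) (hv' : Slow v) (z : Cn n) :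
    productSymbol f g u v z
      = u z * conj (g z) + f z * u z + conj (g z) * conj (v z) + convSymbol f v z := by
  rw [productSymbol, conjSubDeriv, (hasSum_conjSubDerivTerm_conjStar hf hf' hv hv' z).tsum_eq]

theorem growth_productSymbol {n : ℕ} {f g u v : Cn n → ℂ} (hf : Entire f) (hf' : Slow f)
    (hg' : Slow g) (hu' : Slow u) (hv : Entire v) (hv' : Slow v) :
    Growth 0.3 (productSymbol f g u v) := by
  have h := ((((hu'.mul hg'.conj).add (hf'.mul hu')).add (hg'.conj.mul hv'.conj)) 0.3
    (by norm_num)).add (growth_convSymbol (hf' 0.01 (by norm_num)) (hv' 0.01 (by norm_num)))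
  rwa [← funext (productSymbol_eq hf hf' hv hv')] at h

theorem toeplitz_toeplitz_eq_toeplitz_productSymbol {n : ℕ} {f g u v φ ψ : Cn n → ℂ}
    (hf : Entire f) (hf' : Slow f) (hg : Entire g) (hg' : Slow g) (hu : Entire u) (hu' : Slow u)
    (hv : Entire v) (hv' : Slow v) (hφ : ∀ z, φ z = f z + conj (g z))
    (hψ : ∀ z, ψ z = u z + conj (v z)) {k : Cn n → ℂ} (hk : InFock k) (z : Cn n) :
    toeplitz φ (toeplitz ψ k) z = toeplitz (productSymbol f g u v) k z := by
  have hψ' : Slow ψ := by simpa only [← hψ] using hu'.add hv'.conj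
  have hS := growth_convSymbol (hf' 0.01 (by norm_num)) (hv' 0.01 (by norm_num))
  have hKr := slow_kernel_right z
  rw [toeplitz_toeplitz hf hf' hg hg' hφ hψ' hk, toeplitz, proj, ← sub_eq_zero]
  have h1 : Slow fun x => ψ x * ((f z + conj (g x)) * kernel z x) :=
    hψ'.mul (((slow_const _).add hg'.conj).mul hKr)
  have h2 : Growth 0.31 fun x => productSymbol f g u v x * kernel z x :=
    ((growth_productSymbol hf hf' hg' hu' hv hv').mul (hKr 0.01 (by norm_num))).mono (by norm_num)
  -- `A` is the difference of the two integrands without the factor $k$. The terms $u\overline g$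
  -- and $\overline g\,\overline v$ cancel in it, so only the terms with $f$ have to be compared on
  -- kernels.
  have hA := (h1 0.31 (by norm_num)).add h2.neg
  have hA0 := integral_mul_eq_zero_of_kernel hA (by norm_num) ?_ hk
  · rw [← hA0, ← integral_sub]
    · congr 1; ext x; ring
    · refine (integrable_mul_of_inFock hk (h1 0.1 (by norm_num)) (by norm_num)).congr
        (ae_of_all _ fun x => ?_)
      ring
    · refine (integrable_mul_of_inFock hk h2 (by norm_num)).congr (ae_of_all _ fun x => ?_)
      ring
  · intro a
    have hKa := slow_kernel_left a
    have hI : ∀ {F : Cn n → ℂ}, Slow F → Integrable F (gauss n) := fun hF =>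
      (hF 0.1 (by norm_num)).integrable (by norm_num)
    have i1 := (hI ((hu'.mul hKa).mul hKr)).const_mul (f z)
    have i2 := (hI ((hv'.conj.mul hKa).mul hKr)).const_mul (f z)
    have i3 := hI (((hf'.mul hu').mul hKa).mul hKr)
    have i4 := ((hS.mul (hKa 0.1 (by norm_num))).mul (hKr 0.1 (by norm_num))).integrable
      (by norm_num)
    have e1 := integral_mul_kernel_mul_kernel hu hu' a z
    have e2 := integral_conj_mul_kernel_mul_kernel hv hv' a z
    have e3 := integral_mul_kernel_mul_kernel (f := fun x => f x * u x)
      (Differentiable.mul hf hu) (hf'.mul hu') a z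
    have e4 := integral_convSymbol_mul_kernel_mul_kernel hf hf' hv hv' a z
    have hsum := integral_sub (i1.add i2) (i3.add i4)
    rw [integral_add' i1 i2, integral_add' i3 i4, integral_const_mul, integral_const_mul, e1, e2,
      e3, e4] at hsum
    have h0 : f z * (u z * kernel z a) + f z * (conj (v a) * kernel z a)
        - (f z * u z * kernel z a + f z * conj (v a) * kernel z a) = 0 := by ring
    rw [h0] at hsum
    rw [← hsum]
    congr 1; ext x
    rw [productSymbol_eq hf hf' hv hv', hψ]
    simp only [Pi.add_apply]
    ring

/-- Used in (a) to compare $h$ with the product symbol, and in (b) to compare that symbol with $0$.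
-/
theorem ae_eq_of_toeplitz_kernel_eq {n : ℕ} {h σ : Cn n → ℂ} (hh : MemLp h 2 (gauss n))
    (hσ : MemLp σ 2 (gauss n))
    (heq : ∀ a z, toeplitz h (fun w => kernel w a) z = toeplitz σ (fun w => kernel w a) z) :
    h =ᵐ[gauss n] σ := by
  have h0 := ae_eq_zero_of_integral_mul_kernel_mul_kernel (d := fun x => h x - σ x)
    ((hh.sub hσ).integrable (by norm_num)) fun a z => by
      simp only [sub_mul]
      rw [integral_sub ((inDom_kernel_of_memLp hh a).2 z) ((inDom_kernel_of_memLp hσ a).2 z),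
        sub_eq_zero]
      exact heq a z
  filter_upwards [h0] with x hx
  exact sub_eq_zero.1 hx

theorem volume_absolutelyContinuous_gauss (n : ℕ) : (volume : Measure (Cn n)) ≪ gauss n :=
  withDensity_absolutelyContinuous' measurable_gauss_density.aemeasurable
    (ae_of_all _ fun z => (ENNReal.ofReal_pos.2 (by positivity)).ne')

end Fock

theorem mainTheorem3 (n : ℕ) (f g u v φ ψ : Fock.Cn n → ℂ)
    (hf : Fock.InSym f ∧ Fock.Entire f) (hg : Fock.InSym g ∧ Fock.Entire g)
    (hu : Fock.InSym u ∧ Fock.Entire u) (hv : Fock.InSym v ∧ Fock.Entire v)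
    (hφ : ∀ z, φ z = f z + conj (g z)) (hψ : ∀ z, ψ z = u z + conj (v z)) :
    -- the series that defines `v^*(z̄ - ∂_z) f(z)` converges absolutely
    (∀ z, Summable (Fock.conjSubDerivTerm (Fock.conjStar v) f z)) ∧
    -- the product is defined on all reproducing kernels `K_a`
    (∀ a, Fock.InDomMul φ ψ (fun w => Fock.kernel w a)) ∧
    (∀ h : Fock.Cn n → ℂ, MemLp h 2 (Fock.gauss n) →
      (∀ a, Fock.InDom h (fun w => Fock.kernel w a)) ∧
      (Fock.ToeplitzMulEq φ ψ h ↔ h =ᵐ[Fock.gauss n] Fock.productSymbol f g u v)) ∧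
    (Fock.ToeplitzMulEqZero φ ψ ↔ ∀ z, Fock.productSymbol f g u v z = 0) := by
  have hf' := Fock.slow_of_inSym hf
  have hg' := Fock.slow_of_inSym hg
  have hu' := Fock.slow_of_inSym hu
  have hv' := Fock.slow_of_inSym hv
  have hφ' : Fock.Slow φ := by simpa only [← hφ] using hf'.add hg'.conj
  have hψ' : Fock.Slow ψ := by simpa only [← hψ] using hu'.add hv'.conj
  have hdom := Fock.inDomMul_kernel hφ' hψ' hu.2 hu' hv.2 hv' hψ
  have hσ := Fock.growth_productSymbol (u := u) hf.2 hf' hg' hu' hv.2 hv'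
  have hσ2 := hσ.memLp (by norm_num)
  have hT := fun {k} (hk : Fock.InFock k) z =>
    Fock.toeplitz_toeplitz_eq_toeplitz_productSymbol hf.2 hf' hg.2 hg' hu.2 hu' hv.2 hv' hφ hψ hk z
  refine ⟨fun z => (Fock.hasSum_conjSubDerivTerm_conjStar hf.2 hf' hv.2 hv' z).summable, hdom,
    fun h hh => ⟨Fock.inDom_kernel_of_memLp hh, fun H => ?_, fun H k hk _ z => ?_⟩,
    fun H => ?_, fun H k hk z => ?_⟩
  · refine Fock.ae_eq_of_toeplitz_kernel_eq hh hσ2 fun a z => ?_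
    rw [← hT (Fock.inFock_kernel a) z]
    exact (H _ (hdom a) (Fock.inDom_kernel_of_memLp hh a) z).symm
  · rw [hT hk.1.1 z, Fock.toeplitz, Fock.toeplitz, Fock.proj, Fock.proj]
    refine integral_congr_ae ?_
    filter_upwards [H] with x hx
    rw [hx]
  · have h0 : Fock.productSymbol f g u v =ᵐ[Fock.gauss n] 0 := by
      refine Fock.ae_eq_of_toeplitz_kernel_eq hσ2 MemLp.zero fun a z => ?_
      rw [← hT (Fock.inFock_kernel a) z, H _ (hdom a) z]
      simp [Fock.toeplitz, Fock.proj]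
    -- The Gaussian density is positive, so the symbol vanishes Lebesgue-a.e.; being continuous, it
    -- vanishes everywhere.
    have h1 : Fock.productSymbol f g u v =ᵐ[volume] 0 :=
      (Fock.volume_absolutelyContinuous_gauss n).ae_eq h0
    exact congrFun ((hσ.1.ae_eq_iff_eq volume continuous_zero).1 h1)
  · rw [hT hk.1.1 z]
    have h0 : Fock.productSymbol f g u v = fun _ => 0 := funext H
    simp [h0, Fock.toeplitz, Fock.proj]
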